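/- Let $k$ be a field and let $B=\bigoplus_{d\ge 0}B_d$ be a noetherian graded commutative $k$-algebra with $B_0=k$, with maximal ideal $\mathfrak m=B_+=\bigoplus_{d>0}B_d$ and $n=\dim B$. All modules are $\mathbb Z$-graded and need not be finitely generated, and maps of modules preserve degree. The *end* of a graded module $M$, $\operatorname{end}M\in\mathbb Z\cup\{\pm\infty\}$, is the supremum of the degrees $d$ with $M_d\neq 0$ (so $\operatorname{end}0=-\infty$), and we use the convention $\infty+(-\infty)=-\infty$. Put $t^B_p(M)=\operatorname{end}\operatorname{Tor}^B_p(M,k)$. The local cohomology $H^p_{\mathfrak m}(M)$ is graded as the cohomology of the Čech complex on homogeneous elements that generate $\mathfrak m$ up to radical, and $\operatorname{depth}M=\inf\{p: H^p_{\mathfrak m}(M)\ne 0\}$ (so $\operatorname{depth}0=\infty$). For a homogeneous ideal $I$ of $B$ put $$T_j(I)=\max\{t^B_{i_1}(I)+\cdots+t^B_{i_r}(I)\ :\ r\ge 1,\ i_1,\dots,i_r>0,\ i_1+\cdots+i_r=j\}\quad (j>0).$$ **Theorem.** Let $(L_j,d_j)_{j\in\mathbb Z}$, $d_j:L_j\to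 L_{j-1}$, be a complex of graded $B$-modules with homology $H_j=H_j(L)$, and let $i$ be an integer such that for all $j\le i$ the module $L_j$ is bounded below (zero in all sufficiently negative degrees) and has depth at least $n$ (that is, $H^p_{\mathfrak m}(L_j)=0$ for $p<n$). Let $I\subset B$ be a homogeneous ideal with $\dim B/I=0$ such that $IH_j=0$ for all $j\le i$, and suppose that $H_j=0$ for $j\ll 0$. Then $$\operatorname{end}H_i\ \le\ \max\Bigl\{\operatorname{end}H^n_{\mathfrak m}(L_i),\ \sup_{j<i}\bigl\{\operatorname{end}H^n_{\mathfrak m}(L_j)+T_{i-j}(I)\bigr\}\Bigr\}+t^B_n(B/I).$$ -/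

import Mathlib

universe u v w

namespace GradedHomology

open scoped TensorProduct

/-- The end of a `ℤ`-graded module with homogeneous components `gr d`: the supremum of the degrees
`d` with `gr d ≠ 0`. It is `⊥` for the zero module and `⊤` if these degrees are not bounded above.
In `EReal` one has `⊤ + ⊥ = ⊥`. -/
noncomputable def gradedEnd {M : Type v} [AddCommGroup M] (gr : ℤ → AddSubgroup M) : EReal :=
  ⨆ (d : ℤ) (_ : gr d ≠ ⊥), ((d : ℝ) : EReal)

section Subquotient

variable {B : Type u} [CommRing B] {X : Type v} [AddCommGroup X] [Module B X]

/-- The module `Z / (Z ∩ D)`; for `D ≤ Z`, the module of cycles `Z` modulo boundaries `D`. -/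
abbrev Subquot (Z D : Submodule B X) : Type v := ↥Z ⧸ D.submoduleOf Z

/-- The grading which a subquotient inherits from the ambient module: the degree `e` component
consists of the classes of the elements of `Z` that are homogeneous of degree `e`. -/
def subquotGrading (gr : ℤ → AddSubgroup X) (Z D : Submodule B X) (e : ℤ) :
    AddSubgroup (Subquot Z D) :=
  ((gr e).comap Z.subtype.toAddMonoidHom).map (D.submoduleOf Z).mkQ.toAddMonoidHom

end Subquotient

section GradedRing

variable {k : Type w} [Field k] {B : Type u} [CommRing B] [Algebra k B]

/-- The ideal `B₊` (also called `𝔪`) generated by the homogeneous elements of positive degree. -/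
def irrelevantIdeal (𝒜 : ℤ → Submodule k B) : Ideal B :=
  Ideal.span {b | ∃ d : ℤ, 0 < d ∧ b ∈ 𝒜 d}

/-- The grading of an ideal `I` by `I ∩ B_d`. -/
def idealGrading (𝒜 : ℤ → Submodule k B) (I : Ideal B) (d : ℤ) : AddSubgroup I :=
  (𝒜 d).toAddSubgroup.comap I.subtype.toAddMonoidHom

/-- The grading of `B / I` by the images of the `B_d`. -/
def quotientGrading (𝒜 : ℤ → Submodule k B) (I : Ideal B) (d : ℤ) : AddSubgroup (B ⧸ I) :=
  (𝒜 d).toAddSubgroup.map (Ideal.Quotient.mk I).toAddMonoidHom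

/-! ### Graded Tor -/

/-- The grading of the free module on a basis `ι` whose element `s` has degree `deg s`. -/
def freeGrading (𝒜 : ℤ → Submodule k B) {ι : Type u} (deg : ι → ℤ) (e : ℤ) :
    AddSubgroup (ι →₀ B) where
  carrier := {y | ∀ s, y s ∈ 𝒜 (e - deg s)}
  zero_mem' := fun _ => Submodule.zero_mem _
  add_mem' := fun hx hy s => Submodule.add_mem _ (hx s) (hy s)
  neg_mem' := fun hx s => Submodule.neg_mem _ (hx s)

/-- A stage of a graded free resolution: a free module with a basis `ι`, the degrees of the basis
elements, and the submodule `rel` which the next stage has to cover. -/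
structure Stage (B : Type u) [CommRing B] where
  ι : Type u
  deg : ι → ℤ
  rel : Submodule B (ι →₀ B)

/-- The free module on all homogeneous elements of `M`, with the kernel of its map to `M`. -/
noncomputable def Stage.first {M : Type u} [AddCommGroup M] [Module B M]
    (ℳ : ℤ → AddSubgroup M) : Stage B where
  ι := Σ d : ℤ, ℳ d
  deg := Sigma.fst
  rel := LinearMap.ker (Finsupp.linearCombination B (fun s : Σ d : ℤ, ℳ d => (s.2 : M)))

/-- The index set of the next stage: the homogeneous elements of `s.rel`. -/
abbrev Stage.NextIndex (𝒜 : ℤ → Submodule k B) (s : Stage B) : Type u :=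
  Σ e : ℤ, ↥(freeGrading 𝒜 s.deg e ⊓ s.rel.toAddSubgroup)

/-- The map from the free module on the homogeneous elements of `s.rel` onto `s.rel`. -/
noncomputable def Stage.diff (𝒜 : ℤ → Submodule k B) (s : Stage B) :
    (s.NextIndex 𝒜 →₀ B) →ₗ[B] (s.ι →₀ B) :=
  Finsupp.linearCombination B (fun t => (t.2 : s.ι →₀ B))

/-- The free module on all homogeneous elements of `s.rel`, with the kernel of its map to
`s.rel`. -/
noncomputable def Stage.next (𝒜 : ℤ → Submodule k B) (s : Stage B) : Stage B where
  ι := s.NextIndex 𝒜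
  deg := Sigma.fst
  rel := LinearMap.ker (s.diff 𝒜)

/-- The functorial graded free resolution of a graded module `M`: in every step one takes the free
module on all homogeneous elements of the previous kernel. -/
noncomputable def resStage (𝒜 : ℤ → Submodule k B) {M : Type u} [AddCommGroup M] [Module B M]
    (ℳ : ℤ → AddSubgroup M) : ℕ → Stage B
  | 0 => Stage.first ℳ
  | p + 1 => (resStage 𝒜 ℳ p).next 𝒜

section Tor

variable (𝒜 : ℤ → Submodule k B) {M : Type u} [AddCommGroup M] [Module B M]
  (ℳ : ℤ → AddSubgroup M)

/-- The `p`-th term of the resolution. -/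
abbrev Res (p : ℕ) : Type u := (resStage 𝒜 ℳ p).ι →₀ B

/-- The differential of the resolution. -/
noncomputable def resDiff (p : ℕ) : Res 𝒜 ℳ (p + 1) →ₗ[B] Res 𝒜 ℳ p :=
  (resStage 𝒜 ℳ p).diff 𝒜

/-- The `p`-th term of the resolution tensored with `k = B / B₊`. -/
abbrev ResTensor (p : ℕ) : Type u := Res 𝒜 ℳ p ⊗[B] (B ⧸ irrelevantIdeal 𝒜)

/-- The differential of the resolution tensored with `k`. -/
noncomputable def resTensorDiff (p : ℕ) : ResTensor 𝒜 ℳ (p + 1) →ₗ[B] ResTensor 𝒜 ℳ p :=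
  (resDiff 𝒜 ℳ p).rTensor (B ⧸ irrelevantIdeal 𝒜)

/-- The grading of `F_p ⊗ k`, where `k` sits in degree `0`. -/
noncomputable def resTensorGrading (p : ℕ) (e : ℤ) : AddSubgroup (ResTensor 𝒜 ℳ p) :=
  (freeGrading 𝒜 (resStage 𝒜 ℳ p).deg e).map
    ((TensorProduct.mk B (Res 𝒜 ℳ p) (B ⧸ irrelevantIdeal 𝒜)).flip 1).toAddMonoidHom

/-- The cycles of `F ⊗ k`. -/
noncomputable def torCycles : (p : ℕ) → Submodule B (ResTensor 𝒜 ℳ p)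
  | 0 => ⊤
  | p + 1 => LinearMap.ker (resTensorDiff 𝒜 ℳ p)

/-- The boundaries of `F ⊗ k`. -/
noncomputable def torBoundaries (p : ℕ) : Submodule B (ResTensor 𝒜 ℳ p) :=
  LinearMap.range (resTensorDiff 𝒜 ℳ p)

/-- `Tor_p^B(M, k)`. -/
abbrev Tor (p : ℕ) : Type u :=
  Subquot (B := B) (X := ResTensor 𝒜 ℳ p) (torCycles 𝒜 ℳ p) (torBoundaries 𝒜 ℳ p)

/-- The internal grading of `Tor_p^B(M, k)`. -/
noncomputable def torGrading (p : ℕ) : ℤ → AddSubgroup (Tor 𝒜 ℳ p) :=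
  subquotGrading (resTensorGrading 𝒜 ℳ p) (torCycles 𝒜 ℳ p) (torBoundaries 𝒜 ℳ p)

/-- `t_p^B(M)`, the end of `Tor_p^B(M, k)`. -/
noncomputable def torEnd (p : ℕ) : EReal := gradedEnd (torGrading 𝒜 ℳ p)

end Tor

/-- `T_j(I)`: for `j > 0`, the maximum of `t_{i₁}(I) + ⋯ + t_{i_r}(I)` over all compositions
`j = i₁ + ⋯ + i_r` into positive parts; `-∞` for `j ≤ 0`. -/
noncomputable def maxTorSum (𝒜 : ℤ → Submodule k B) (I : Ideal B) (j : ℤ) : EReal :=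
  if 0 < j then
    ⨆ c : Composition j.toNat, (c.blocks.map (torEnd 𝒜 (idealGrading 𝒜 I))).sum
  else ⊥

/-! ### Graded local cohomology through the Čech complex -/

section Cech

/-- Homogeneous elements `x₁, …, x_r` which generate `B₊` up to radical. -/
structure IsCechFamily (𝒜 : ℤ → Submodule k B) {r : ℕ} (x : Fin r → B) : Prop where
  homogeneous : ∀ a, ∃ d : ℤ, x a ∈ 𝒜 d
  radical_eq : (Ideal.span (Set.range x)).radical = irrelevantIdeal 𝒜

variable {r : ℕ} (x : Fin r → B) (M : Type v) [AddCommGroup M] [Module B M]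

/-- The multiplicative set generated by the `x_a`, `a ∈ S`. -/
def cechMonoid (S : Finset (Fin r)) : Submonoid B := Submonoid.closure (x '' S)

theorem cechMonoid_mono {S T : Finset (Fin r)} (h : S ⊆ T) : cechMonoid x S ≤ cechMonoid x T :=
  Submonoid.closure_mono (Set.image_mono (Finset.coe_subset.2 h))

/-- The localization of `M` in which the `x_a`, `a ∈ S`, are inverted. -/
abbrev CechLoc (S : Finset (Fin r)) : Type (max u v) := LocalizedModule (cechMonoid x S) M

/-- The localization map `M_S → M_T` for `S ⊆ T`. -/
noncomputable def cechRes {S T : Finset (Fin r)} (h : S ⊆ T) :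
    CechLoc x M S →ₗ[B] CechLoc x M T :=
  IsLocalizedModule.liftOfLE (cechMonoid x S) (cechMonoid x T) (cechMonoid_mono x h)
    (LocalizedModule.mkLinearMap (cechMonoid x S) M)
    (LocalizedModule.mkLinearMap (cechMonoid x T) M)

/-- The `p`-th term of the Čech complex. -/
abbrev Cech (p : ℕ) : Type (max u v) :=
  (S : {S : Finset (Fin r) // S.card = p}) → CechLoc x M S.1

/-- The differential of the Čech complex,
`(d α)_T = ∑_{a ∈ T} (-1)^{#{b ∈ T | b < a}} α_{T \ a}`. -/
noncomputable def cechDiff (p : ℕ) : Cech x M p →ₗ[B] Cech x M (p + 1) :=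
  LinearMap.pi fun T => ∑ a : {a // a ∈ T.1},
    ((-1 : ℤ) ^ (T.1.filter (fun b => b < a.1)).card) •
      (cechRes x M (T.1.erase_subset a.1) ∘ₗ
        LinearMap.proj (R := B)
          (φ := fun S : {S : Finset (Fin r) // S.card = p} => CechLoc x M S.1)
          ⟨T.1.erase a.1, by rw [Finset.card_erase_of_mem a.2, T.2, Nat.add_sub_cancel]⟩)

/-- The coboundaries of the Čech complex. -/
noncomputable def cechBoundaries : (p : ℕ) → Submodule B (Cech x M p)
  | 0 => ⊥
  | p + 1 => LinearMap.range (cechDiff x M p)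

/-- The local cohomology module `H^p_𝔪(M)`, computed on the family `x`. -/
abbrev LocCoh (p : ℕ) : Type (max u v) :=
  Subquot (LinearMap.ker (cechDiff x M p)) (cechBoundaries x M p)

/-- The depth of a module which need not be finitely generated, that is
`inf {p | H^p_𝔪(M) ≠ 0}`; it is `⊤` if there is no such `p`, in particular for `M = 0`. -/
noncomputable def lcDepth : ℕ∞ := ⨅ (p : ℕ) (_ : Nontrivial (LocCoh x M p)), (p : ℕ∞)

variable {M}
variable (𝒜 : ℤ → Submodule k B) [GradedAlgebra 𝒜]
  (ℳ : ℤ → AddSubgroup M) [SetLike.GradedSMul 𝒜 ℳ]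

/-- The grading of a localization: the component of degree `d` consists of the fractions `m / s`
with `s` homogeneous of some degree `a` and `m` homogeneous of degree `a + d`. -/
def locGrading (S : Finset (Fin r)) (d : ℤ) : AddSubgroup (CechLoc x M S) where
  carrier := {y | ∃ (a : ℤ) (m : M) (s : cechMonoid x S),
    (s : B) ∈ 𝒜 a ∧ m ∈ ℳ (a + d) ∧ y = LocalizedModule.mk m s}
  zero_mem' := ⟨0, 0, 1, SetLike.GradedOne.one_mem, AddSubgroup.zero_mem _, by simp⟩
  add_mem' := by
    rintro _ _ ⟨a, m, s, hs, hm, rfl⟩ ⟨b, m', s', hs', hm', rfl⟩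
    refine ⟨a + b, s' • m + s • m', s * s', SetLike.GradedMul.mul_mem hs hs',
      AddSubgroup.add_mem _ ?_ ?_, LocalizedModule.mk_add_mk⟩
    · have h : (s' : B) • m ∈ ℳ (b +ᵥ (a + d)) := SetLike.GradedSMul.smul_mem hs' hm
      have e : b +ᵥ (a + d) = a + b + d := by rw [vadd_eq_add]; ring
      rwa [e] at h
    · have h : (s : B) • m' ∈ ℳ (a +ᵥ (b + d)) := SetLike.GradedSMul.smul_mem hs hm'
      have e : a +ᵥ (b + d) = a + b + d := by rw [vadd_eq_add]; ring
      rwa [e] at h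
  neg_mem' := by
    rintro _ ⟨a, m, s, hs, hm, rfl⟩
    exact ⟨a, -m, s, hs, AddSubgroup.neg_mem _ hm, LocalizedModule.mk_neg.symm⟩

/-- The grading of the terms of the Čech complex. -/
def cechGrading (p : ℕ) (d : ℤ) : AddSubgroup (Cech x M p) :=
  AddSubgroup.pi Set.univ fun S => locGrading x 𝒜 ℳ S.1 d

/-- `end H^p_𝔪(M)`. -/
noncomputable def locCohEnd (p : ℕ) : EReal :=
  gradedEnd (subquotGrading (cechGrading x 𝒜 ℳ p)
    (LinearMap.ker (cechDiff x M p)) (cechBoundaries x M p))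

end Cech

/-! ### Homology of a complex of graded modules -/

section Complex

variable (L : ChainComplex (ModuleCat.{v} B) ℤ)

/-- The cycles `Z_j` of `L`. -/
def cycles (j : ℤ) : Submodule B (L.X j) := LinearMap.ker (L.d j (j - 1)).hom

/-- The boundaries of `L` in homological degree `j`. -/
def boundaries (j : ℤ) : Submodule B (L.X j) := LinearMap.range (L.d (j + 1) j).hom

/-- The homology `H_j` of `L`. -/
abbrev Homology (j : ℤ) : Type v := Subquot (cycles L j) (boundaries L j)

/-- `end H_j`, for the grading of `H_j` induced by the grading of `L_j`. -/
noncomputable def homologyEnd (ℒ : (j : ℤ) → ℤ → AddSubgroup (L.X j)) (j : ℤ) : EReal :=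
  gradedEnd (subquotGrading (ℒ j) (cycles L j) (boundaries L j))

end Complex

end GradedRing

end GradedHomology

/-!
Let `Z_i` be the cycles of `L_i` and `y ∈ Z_i` homogeneous of degree `e`; since `I H_i = 0`, it
represents zero in `H_i` as soon as `y ∈ I Z_i`. Take a graded free resolution `F → B / I` and
form the double complex `F ⊗ Č(Z_i)`. A power of each `x_a` lies in `I`, so `F ⊗ (Z_i)_S` is exact
for all `S ≠ ∅`, and starting from `y` in `F_0 ⊗ Z_i` one builds a staircase of cochains of degree
`e`. On `H^p_𝔪(Z_i)`, on which `𝔪` acts locally nilpotently, `Tor_p(B / I, -)` is controlled by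
`Tor_p(B / I, k)`. So the staircase can be corrected to one which gives `y ∈ I Z_i`, unless for
some `p` a degree of `H^p_𝔪(Z_i)` and a degree of `Tor_p(B / I, k)` add up to `e`.

The depth of the `L_j` and the vanishing of the higher local cohomology of the homology, which is
`I`-torsion, shift `H^p_𝔪(Z_i)` through the short exact sequences `0 → Z_j → L_j → D_{j-1} → 0`
and `0 → D_j → Z_j → H_j → 0` with `D_j` the boundaries, until it becomes `H_{i+1-p}` or, for
`p = n`, also `H^n_𝔪(L_i)`. In the first case `Tor_p(B / I, k) = Tor_{p-1}(I, k)`, and the argument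
is repeated for `H_{i+1-p}`. The homological degrees used up form a composition of `i - j`, which is
where `T_{i-j}(I)` comes from.
-/

namespace GradedHomology

open DirectSum (IsInternal decompose)

/-! ### Internal direct sum decompositions -/

section Internal

variable {ι : Type*} [DecidableEq ι] {X Y : Type*} [AddCommGroup X] [AddCommGroup Y]
  {gr : ι → AddSubgroup X} {gr' : ι → AddSubgroup Y}

theorem isInternal_of_iSup_eq_top_of_sum_eq_zero (hspan : ⨆ d, gr d = ⊤)
    (hindep : ∀ (T : Finset ι) (c : ι → X), (∀ d ∈ T, c d ∈ gr d) → ∑ d ∈ T, c d = 0 →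
      ∀ d ∈ T, c d = 0) : IsInternal gr := by
  classical
  refine ⟨(injective_iff_map_eq_zero _).2 fun z hz => ?_, fun y => ?_⟩
  · rw [DirectSum.coeAddMonoidHom_eq_dfinsuppSum] at hz
    ext d
    by_cases hd : d ∈ DFinsupp.support z
    · exact hindep _ (fun d => z d) (fun d _ => (z d).2) hz d hd
    · simpa using hd
  · refine AddSubgroup.iSup_induction gr
      (C := fun y => ∃ a, DirectSum.coeAddMonoidHom gr a = y) (hspan ▸ AddSubgroup.mem_top y)
      (fun d z hz => ⟨DirectSum.of (gr ·) d ⟨z, hz⟩, DirectSum.coeAddMonoidHom_of _ _ _⟩)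
      ⟨0, map_zero (DirectSum.coeAddMonoidHom gr)⟩ ?_
    rintro _ _ ⟨a, rfl⟩ ⟨b, rfl⟩
    exact ⟨a + b, map_add _ a b⟩

theorem coe_decompose_map [DirectSum.Decomposition gr] [DirectSum.Decomposition gr'] (f : X →+ Y)
    (hf : ∀ d, ∀ z ∈ gr d, f z ∈ gr' d) (y : X) (d : ι) :
    (decompose gr' (f y) d : Y) = f (decompose gr y d) := by
  induction y using DirectSum.Decomposition.inductionOn gr with
  | zero => simp
  | @homogeneous e z =>
    rw [DirectSum.decompose_of_mem _ (hf e z z.2), DirectSum.decompose_coe, DirectSum.coe_of_apply,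
      DirectSum.coe_of_apply]
    split_ifs with h <;> simp
  | add y z hy hz => simp [hy, hz]

theorem map_mem_of_isInternal (h : IsInternal gr) (f : X →+ Y) {K : AddSubgroup Y}
    (hf : ∀ d, ∀ z ∈ gr d, f z ∈ K) (y : X) : f y ∈ K := by
  let := h.chooseDecomposition
  induction y using DirectSum.Decomposition.inductionOn gr with
  | zero => exact map_zero f ▸ K.zero_mem
  | homogeneous z => exact hf _ z z.2
  | add y z hy hz => exact map_add f y z ▸ K.add_mem hy hz

theorem coe_decompose_sum [DirectSum.Decomposition gr] {T : Finset ι} {c : ι → X}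
    (hc : ∀ d ∈ T, c d ∈ gr d) {d : ι} (hd : d ∈ T) :
    (decompose gr (∑ e ∈ T, c e) d : X) = c d := by
  rw [DirectSum.decompose_sum, DFinsupp.finsetSum_apply, AddSubmonoidClass.coe_finsetSum,
    Finset.sum_eq_single_of_mem d hd fun e he hed =>
      DirectSum.decompose_of_mem_ne gr (hc e he) hed,
    DirectSum.decompose_of_mem_same gr (hc d hd)]

theorem eq_zero_of_sum_eq_zero (h : IsInternal gr) {T : Finset ι} {c : ι → X}
    (hc : ∀ d ∈ T, c d ∈ gr d) (h0 : ∑ d ∈ T, c d = 0) : ∀ d ∈ T, c d = 0 := by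
  let := h.chooseDecomposition
  intro d hd
  rw [← coe_decompose_sum hc hd, h0, DirectSum.decompose_zero, DirectSum.zero_apply,
    ZeroMemClass.coe_zero]

theorem exists_homogeneous_preimage (h : IsInternal gr) (h' : IsInternal gr') (f : X →+ Y)
    (hf : ∀ d, ∀ z ∈ gr d, f z ∈ gr' d) {d : ι} {y : X} (hy : f y ∈ gr' d) :
    ∃ z ∈ gr d, f z = f y := by
  let := h.chooseDecomposition
  let := h'.chooseDecomposition
  refine ⟨decompose gr y d, (decompose gr y d).2, ?_⟩
  rw [← coe_decompose_map f hf, DirectSum.decompose_of_mem_same gr' hy]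

theorem isInternal_comp_equiv (h : IsInternal gr) {κ : Type*} [DecidableEq κ]
    (σ : κ ≃ ι) : IsInternal fun d => gr (σ d) := by
  refine isInternal_of_iSup_eq_top_of_sum_eq_zero (eq_top_iff.2 fun y _ => ?_)
    fun T c hc h0 d hd => ?_
  · rw [σ.surjective.iSup_comp gr]
    exact map_mem_of_isInternal h (AddMonoidHom.id X)
      (fun d z hz => AddSubgroup.mem_iSup_of_mem d hz) y
  · have := eq_zero_of_sum_eq_zero h (T := T.map σ.toEmbedding) (c := c ∘ σ.symm)
      (Finset.forall_mem_map.2 fun d hd => by simpa using hc d hd) (by simpa using h0) (σ d)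
      (by simpa using hd)
    simpa using this

theorem isInternal_comap_of_injective [DirectSum.Decomposition gr] {f : Y →+ X}
    (hf : Function.Injective f) (hrange : ∀ y d, (decompose gr (f y) d : X) ∈ f.range) :
    IsInternal fun d => (gr d).comap f := by
  classical
  refine isInternal_of_iSup_eq_top_of_sum_eq_zero (eq_top_iff.2 fun y _ => ?_)
    fun T c hc h0 d hd => hf ?_
  · choose c hc using hrange y
    have hsum : y = ∑ d ∈ (decompose gr (f y)).support, c d := by
      apply hf
      rw [map_sum, Finset.sum_congr rfl fun d _ => hc d, DirectSum.sum_support_decompose]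
    rw [hsum]
    exact sum_mem fun d _ => AddSubgroup.mem_iSup_of_mem d (by
      rw [AddSubgroup.mem_comap, hc d]; exact SetLike.coe_mem _)
  · rw [map_zero]
    exact eq_zero_of_sum_eq_zero (DirectSum.Decomposition.isInternal gr) hc
      (by rw [← map_sum, h0, map_zero]) d hd

theorem isInternal_comap_ker (h : IsInternal gr) (h' : IsInternal gr') (f : X →+ Y)
    (hf : ∀ d, ∀ z ∈ gr d, f z ∈ gr' d) : IsInternal fun d => (gr d).comap f.ker.subtype := by
  let := h.chooseDecomposition
  let := h'.chooseDecomposition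
  refine isInternal_comap_of_injective f.ker.subtype_injective fun y d => ?_
  rw [AddSubgroup.range_subtype, AddMonoidHom.mem_ker, ← coe_decompose_map f hf]
  simp [AddMonoidHom.mem_ker.1 y.2]

theorem isInternal_map_of_surjective [DirectSum.Decomposition gr] {f : X →+ Y}
    (hf : Function.Surjective f) (hker : ∀ y ∈ f.ker, ∀ d, (decompose gr y d : X) ∈ f.ker) :
    IsInternal fun d => (gr d).map f := by
  refine isInternal_of_iSup_eq_top_of_sum_eq_zero (eq_top_iff.2 fun y _ => ?_)
    fun T c hc h0 d hd => ?_
  · obtain ⟨y, rfl⟩ := hf y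
    exact map_mem_of_isInternal (DirectSum.Decomposition.isInternal gr) f
      (fun d z hz => AddSubgroup.mem_iSup_of_mem d (AddSubgroup.mem_map_of_mem f hz)) y
  · choose! c' hc' hcc' using hc
    rw [← hcc' d hd, ← coe_decompose_sum hc' hd]
    refine hker _ ?_ d
    rw [AddMonoidHom.mem_ker, map_sum, Finset.sum_congr rfl hcc', h0]

theorem isInternal_pi {κ : Type*} [Finite κ] {Z : κ → Type*} [∀ s, AddCommGroup (Z s)]
    {gr : ∀ s, ι → AddSubgroup (Z s)} (h : ∀ s, IsInternal (gr s)) :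
    IsInternal fun d => AddSubgroup.pi Set.univ fun s => gr s d := by
  classical
  have := Fintype.ofFinite κ
  refine isInternal_of_iSup_eq_top_of_sum_eq_zero (eq_top_iff.2 fun y _ => ?_)
    fun T c hc h0 d hd => ?_
  · rw [← Finset.univ_sum_single y]
    refine sum_mem fun s _ => map_mem_of_isInternal (h s) (AddMonoidHom.single Z s)
      (fun d z hz => AddSubgroup.mem_iSup_of_mem d fun t _ => ?_) (y s)
    rw [AddMonoidHom.single_apply]
    obtain rfl | hts := eq_or_ne t s
    · rwa [Pi.single_eq_same]
    · rw [Pi.single_eq_of_ne hts]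
      exact (gr t d).zero_mem
  · funext s
    refine eq_zero_of_sum_eq_zero (h s) (c := fun d => c d s)
      (fun d hd => hc d hd s (Set.mem_univ s)) ?_ d hd
    rw [← Finset.sum_apply, h0, Pi.zero_apply]

end Internal

section FinGrading

variable {X : Type*} [AddCommGroup X] {ι : Type*} {deg : ι → ℤ} {gr : ℤ → AddSubgroup X}

/-- The grading of a free module with basis `ι`, the element `s` having degree `deg s`, with
coefficients in a graded module `X`. For `X = B` this is `freeGrading`. -/
def finGrading (deg : ι → ℤ) (gr : ℤ → AddSubgroup X) (e : ℤ) : AddSubgroup (ι →₀ X) where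
  carrier := {y | ∀ s, y s ∈ gr (e - deg s)}
  zero_mem' := fun _ => zero_mem _
  add_mem' := fun hx hy s => add_mem (hx s) (hy s)
  neg_mem' := fun hx s => neg_mem (hx s)

theorem single_mem_finGrading {e : ℤ} {s : ι} {z : X} (hz : z ∈ gr (e - deg s)) :
    Finsupp.single s z ∈ finGrading deg gr e := by
  classical
  intro t
  rw [Finsupp.single_apply]
  split_ifs with h
  · exact h ▸ hz
  · exact zero_mem _

theorem exists_mapRange_eq_of_mem_finGrading_map {B : Type*} [Semiring B] [Module B X] {Y : Type*}
    [AddCommGroup Y] [Module B Y] (f : X →ₗ[B] Y) {e : ℤ} {y : ι →₀ Y}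
    (hy : y ∈ finGrading deg (fun d => (gr d).map f.toAddMonoidHom) e) :
    ∃ z ∈ finGrading deg gr e, Finsupp.mapRange.linearMap f z = y := by
  choose c hc hcy using hy
  refine ⟨∑ s ∈ y.support, Finsupp.single s (c s),
    sum_mem fun s _ => single_mem_finGrading (hc s), ?_⟩
  conv_rhs => rw [← Finsupp.sum_single y, Finsupp.sum]
  rw [map_sum]
  refine Finset.sum_congr rfl fun s _ => ?_
  rw [Finsupp.mapRange.linearMap_apply, Finsupp.mapRange_single, ← hcy s]
  rfl

theorem isInternal_finGrading (deg : ι → ℤ) (h : IsInternal gr) :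
    IsInternal (finGrading deg gr) := by
  refine isInternal_of_iSup_eq_top_of_sum_eq_zero (eq_top_iff.2 fun y _ => ?_)
    fun T c hc h0 d hd => ?_
  · induction y using Finsupp.induction_linear with
    | zero => exact zero_mem _
    | add f g hf hg => exact add_mem (hf trivial) (hg trivial)
    | single s z =>
      exact map_mem_of_isInternal h (Finsupp.singleAddHom s) (fun d z hz =>
        AddSubgroup.mem_iSup_of_mem (d + deg s)
          (single_mem_finGrading ((add_sub_cancel_right d (deg s)).symm ▸ hz))) z
  · ext s
    refine eq_zero_of_sum_eq_zero (isInternal_comp_equiv h (Equiv.subRight (deg s)))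
      (fun d hd => hc d hd s) ?_ d hd
    rw [← Finsupp.finsetSum_apply, h0, Finsupp.zero_apply]

end FinGrading

section GradedRing

variable {k : Type w} [Field k] {B : Type u} [CommRing B] [Algebra k B]
  (𝒜 : ℤ → Submodule k B)

theorem grSmul_mem {M : Type*} [AddCommGroup M] [Module B M] (ℳ : ℤ → AddSubgroup M)
    [SetLike.GradedSMul 𝒜 ℳ] {a d : ℤ} {b : B} {m : M} (hb : b ∈ 𝒜 a) (hm : m ∈ ℳ d) :
    b • m ∈ ℳ (a + d) :=
  SetLike.GradedSMul.smul_mem hb hm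

variable [GradedAlgebra 𝒜]

instance decompositionToAddSubgroup :
    DirectSum.Decomposition fun d => (𝒜 d).toAddSubgroup where
  decompose' := DirectSum.Decomposition.decompose' (ℳ := 𝒜)
  left_inv := DirectSum.Decomposition.left_inv (ℳ := 𝒜)
  right_inv := DirectSum.Decomposition.right_inv (ℳ := 𝒜)

theorem isInternal_toAddSubgroup : IsInternal fun d => (𝒜 d).toAddSubgroup :=
  DirectSum.Decomposition.isInternal _

variable {𝒜} {I : Ideal B}

theorem isInternal_idealGrading (hI : I.IsHomogeneous 𝒜) : IsInternal (idealGrading 𝒜 I) :=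
  isInternal_comap_of_injective (f := I.subtype.toAddMonoidHom) Subtype.val_injective
    fun y d => ⟨⟨_, hI d y.2⟩, rfl⟩

theorem isInternal_quotientGrading (hI : I.IsHomogeneous 𝒜) :
    IsInternal (quotientGrading 𝒜 I) := by
  refine isInternal_map_of_surjective (f := (Ideal.Quotient.mk I).toAddMonoidHom)
    Ideal.Quotient.mk_surjective fun y hy d => ?_
  exact Ideal.Quotient.eq_zero_iff_mem.2 (hI d (Ideal.Quotient.eq_zero_iff_mem.1 hy))

end GradedRing

/-! ### The Čech complex -/

section Cech

variable {B : Type u} [CommRing B] {r : ℕ} (x : Fin r → B)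
  {M : Type v} [AddCommGroup M] [Module B M]

theorem cechRes_mk {S T : Finset (Fin r)} (h : S ⊆ T) (m : M) (s : cechMonoid x S) :
    cechRes x M h (LocalizedModule.mk m s) =
      LocalizedModule.mk m ⟨s.1, cechMonoid_mono x h s.2⟩ := by
  rw [IsLocalizedModule.mk_eq_mk', IsLocalizedModule.mk_eq_mk', cechRes,
    IsLocalizedModule.liftOfLE_mk']

theorem cechRes_cechRes {S T U : Finset (Fin r)} (h : S ⊆ T) (h' : T ⊆ U) (y : CechLoc x M S) :
    cechRes x M h' (cechRes x M h y) = cechRes x M (h.trans h') y := by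
  induction y using LocalizedModule.induction_on with
  | h m s => rw [cechRes_mk, cechRes_mk, cechRes_mk]

/-- The sign with which the component `T \ a` enters the component `T` of a Čech coboundary. -/
def cechSign (B : Type u) [CommRing B] (a : Fin r) (T : Finset (Fin r)) : B :=
  (-1) ^ (T.filter (fun b => b < a)).card

theorem cechSign_mul_self (a : Fin r) (T : Finset (Fin r)) :
    cechSign B a T * cechSign B a T = 1 := by
  rw [cechSign, ← mul_pow, neg_one_mul, neg_neg, one_pow]

theorem cechSign_smul_cechSign_smul (a : Fin r) (T : Finset (Fin r)) (m : M) :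
    cechSign B a T • cechSign B a T • m = m := by
  rw [smul_smul, cechSign_mul_self, one_smul]

theorem cechSign_erase_of_lt {a b : Fin r} {T : Finset (Fin r)} (hb : b ∈ T) (h : b < a) :
    cechSign B a (T.erase b) = -cechSign B a T := by
  have hm : b ∈ T.filter (fun c => c < a) := Finset.mem_filter.2 ⟨hb, h⟩
  rw [cechSign, cechSign, Finset.filter_erase, ← Finset.card_erase_add_one hm, pow_succ]
  ring

theorem cechSign_erase_of_gt {a b : Fin r} {T : Finset (Fin r)} (h : a < b) :
    cechSign B a (T.erase b) = cechSign B a T := by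
  rw [cechSign, Finset.filter_erase, Finset.erase_eq_of_notMem, cechSign]
  simp [h.le]

theorem cechSign_mul_cechSign_erase {a b : Fin r} {T : Finset (Fin r)} (ha : a ∈ T) (hb : b ∈ T)
    (hab : a ≠ b) :
    cechSign B a T * cechSign B b (T.erase a) = -(cechSign B b T * cechSign B a (T.erase b)) := by
  rcases lt_or_gt_of_ne hab with h | h
  · rw [cechSign_erase_of_lt ha h, cechSign_erase_of_gt h]; ring
  · rw [cechSign_erase_of_gt h, cechSign_erase_of_lt hb h]; ring

variable (M)

/-- The product of all terms of the Čech complex. Working with families indexed by all subsets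
avoids keeping track of cardinalities. -/
abbrev CechFamily : Type (max u v) := (S : Finset (Fin r)) → CechLoc x M S

/-- The Čech differential on families indexed by all subsets. -/
noncomputable def cechTotal : CechFamily x M →ₗ[B] CechFamily x M :=
  LinearMap.pi fun T => ∑ a ∈ T, cechSign B a T • (cechRes x M (T.erase_subset a) ∘ₗ
    LinearMap.proj (φ := fun S => CechLoc x M S) (T.erase a))

variable {M}

/-- The extension by zero of a Čech cochain to all subsets. -/
noncomputable def cechExt {p : ℕ} (α : Cech x M p) : CechFamily x M := fun S =>
  if h : S.card = p then α ⟨S, h⟩ else 0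

theorem cechTotal_apply (α : CechFamily x M) (T : Finset (Fin r)) :
    cechTotal x M α T =
      ∑ a ∈ T, cechSign B a T • cechRes x M (T.erase_subset a) (α (T.erase a)) := by
  simp [cechTotal]

theorem cechExt_apply {p : ℕ} (α : Cech x M p) (S : {S : Finset (Fin r) // S.card = p}) :
    cechExt x α S.1 = α S := dif_pos S.2

theorem cechDiff_restrict {p : ℕ} (α : CechFamily x M)
    (T : {S : Finset (Fin r) // S.card = p + 1}) :
    cechDiff x M p (fun S => α S.1) T = cechTotal x M α T.1 := by
  unfold cechDiff
  rw [LinearMap.pi_apply, LinearMap.sum_apply, cechTotal_apply, ← Finset.sum_coe_sort T.1 fun a =>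
    cechSign B a T.1 • cechRes x M (T.1.erase_subset a) (α (T.1.erase a))]
  refine Finset.sum_congr rfl fun a _ => ?_
  rw [show cechSign B a.1 T.1 = (((-1 : ℤ) ^ (T.1.filter (fun b => b < a.1)).card : ℤ) : B) by
    simp [cechSign], Int.cast_smul_eq_zsmul B]
  rfl

theorem cechDiff_apply {p : ℕ} (α : Cech x M p) (T : {S : Finset (Fin r) // S.card = p + 1}) :
    cechDiff x M p α T = cechTotal x M (cechExt x α) T.1 := by
  rw [← cechDiff_restrict]
  simp only [cechExt_apply]

theorem cechExt_cechDiff {p : ℕ} (α : Cech x M p) :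
    cechExt x (cechDiff x M p α) = cechTotal x M (cechExt x α) := by
  funext S
  by_cases h : S.card = p + 1
  · exact (cechExt_apply x _ ⟨S, h⟩).trans (cechDiff_apply x α ⟨S, h⟩)
  · rw [cechExt, dif_neg h, cechTotal_apply, Finset.sum_eq_zero]
    intro a ha
    rw [cechExt, dif_neg, map_zero, smul_zero]
    have := Finset.card_erase_add_one ha
    omega

theorem cechTotal_cechTotal (α : CechFamily x M) : cechTotal x M (cechTotal x M α) = 0 := by
  classical
  funext T
  let res (S : Finset (Fin r)) : CechLoc x M T := if h : S ⊆ T then cechRes x M h (α S) else 0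
  have hres : cechTotal x M (cechTotal x M α) T = ∑ a ∈ T, ∑ b ∈ T.erase a,
      (cechSign B a T * cechSign B b (T.erase a)) • res ((T.erase a).erase b) := by
    rw [cechTotal_apply]
    refine Finset.sum_congr rfl fun a _ => ?_
    rw [cechTotal_apply, map_sum, Finset.smul_sum]
    refine Finset.sum_congr rfl fun b _ => ?_
    rw [map_smul, smul_smul, cechRes_cechRes]
    congr 1
    simp only [res, dif_pos (((T.erase a).erase_subset b).trans (T.erase_subset a))]
  rw [hres, Finset.sum_sigma']
  refine Finset.sum_involution (fun q _ => ⟨q.2, q.1⟩) ?_ ?_ ?_ fun _ _ => rfl <;>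
    rintro ⟨a, b⟩ h <;> simp only [Finset.mem_sigma, Finset.mem_erase] at h ⊢
  · rw [cechSign_mul_cechSign_erase h.1 h.2.2 h.2.1.symm, Finset.erase_right_comm, neg_smul,
      neg_add_cancel]
  · exact fun _ h' => h.2.1 (congrArg Sigma.fst h')
  · exact ⟨h.2.2, h.2.1.symm, h.1⟩

theorem cechBoundaries_le_ker (p : ℕ) :
    cechBoundaries x M p ≤ LinearMap.ker (cechDiff x M p) := by
  cases p with
  | zero => exact bot_le
  | succ p =>
    rintro _ ⟨α, rfl⟩
    funext T
    rw [cechDiff_apply, cechExt_cechDiff, cechTotal_cechTotal]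
    rfl

/-! ### Powers of the elements of the family kill the Čech cohomology -/

theorem mem_cechMonoid {a : Fin r} {T : Finset (Fin r)} (ha : a ∈ T) : x a ∈ cechMonoid x T :=
  Submonoid.subset_closure ⟨a, ha, rfl⟩

theorem exists_eq_pow_mul_of_mem_cechMonoid_insert {a : Fin r} {T : Finset (Fin r)} {t : B}
    (ht : t ∈ cechMonoid x (insert a T)) : ∃ s ∈ cechMonoid x T, ∃ K : ℕ, t = x a ^ K * s := by
  unfold cechMonoid at ht
  rw [Finset.coe_insert, Set.image_insert_eq, Set.insert_eq, Submonoid.closure_union,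
    Submonoid.mem_sup] at ht
  obtain ⟨y, hy, z, hz, rfl⟩ := ht
  obtain ⟨K, rfl⟩ := Submonoid.mem_closure_singleton.1 hy
  exact ⟨z, hz, K, rfl⟩

theorem exists_pow_smul_eq_cechRes_insert {a : Fin r} {S : Finset (Fin r)}
    (y : CechLoc x M (insert a S)) :
    ∃ (K : ℕ) (z : CechLoc x M S), cechRes x M (S.subset_insert a) z = x a ^ K • y := by
  induction y using LocalizedModule.induction_on with
  | h m t =>
    obtain ⟨s, hs, K, hK⟩ := exists_eq_pow_mul_of_mem_cechMonoid_insert x t.2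
    refine ⟨K, LocalizedModule.mk m ⟨s, hs⟩, ?_⟩
    rw [cechRes_mk, LocalizedModule.smul'_mk, LocalizedModule.mk_eq]
    refine ⟨1, ?_⟩
    simp only [one_smul, Submonoid.smul_def, hK, smul_smul]
    rw [mul_comm]

theorem exists_pow_smul_eq_zero_of_cechRes_insert {a : Fin r} {S : Finset (Fin r)}
    {y : CechLoc x M S} (hy : cechRes x M (S.subset_insert a) y = 0) :
    ∃ K : ℕ, x a ^ K • y = 0 := by
  induction y using LocalizedModule.induction_on with
  | h m t =>
    rw [cechRes_mk, ← LocalizedModule.zero_mk 1, LocalizedModule.mk_eq] at hy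
    obtain ⟨v, hv⟩ := hy
    obtain ⟨s, hs, K, hK⟩ := exists_eq_pow_mul_of_mem_cechMonoid_insert x v.2
    refine ⟨K, ?_⟩
    rw [LocalizedModule.smul'_mk, ← LocalizedModule.zero_mk 1, LocalizedModule.mk_eq]
    refine ⟨⟨s, hs⟩, ?_⟩
    simp only [one_smul, smul_zero, Submonoid.smul_def, hK, smul_smul] at hv ⊢
    rw [mul_comm]
    exact hv

theorem pow_smul_eq_zero_of_le {b : B} {K K' : ℕ} (h : K ≤ K') {y : M} (hy : b ^ K • y = 0) :
    b ^ K' • y = 0 := by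
  rw [← Nat.sub_add_cancel h, pow_add, mul_smul, hy, smul_zero]

theorem cechTotal_insert {a : Fin r} {S : Finset (Fin r)} (ha : a ∉ S) (α : CechFamily x M) :
    cechTotal x M α (insert a S) =
      cechSign B a (insert a S) • cechRes x M (S.subset_insert a) (α S) +
        ∑ b ∈ S, cechSign B b (insert a S) •
          cechRes x M ((insert a S).erase_subset b) (α ((insert a S).erase b)) := by
  have hcongr (U : Finset (Fin r)) (hU : U = S) (h : U ⊆ insert a S) :
      cechRes x M h (α U) = cechRes x M (S.subset_insert a) (α S) := by
    subst hU; rfl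
  rw [cechTotal_apply, Finset.sum_insert ha, hcongr _ (Finset.erase_insert ha)]

theorem exists_cechTotal_eq_pow_smul_of_mem (a : Fin r) (α : CechFamily x M) :
    ∃ (K : ℕ) (β : CechFamily x M), ∀ T, a ∈ T → cechTotal x M β T = x a ^ K • α T := by
  classical
  choose K z hz using fun S => exists_pow_smul_eq_cechRes_insert x (S := S) (α (insert a S))
  let N := Finset.univ.sup K
  let β : CechFamily x M := fun S =>
    if a ∈ S then 0 else cechSign B a (insert a S) • x a ^ (N - K S) • z S
  refine ⟨N, β, fun T ha => ?_⟩
  obtain ⟨S, haS, rfl⟩ : ∃ S, a ∉ S ∧ insert a S = T :=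
    ⟨T.erase a, T.notMem_erase a, Finset.insert_erase ha⟩
  have hβ (U : Finset (Fin r)) (hU : a ∈ U) : β U = 0 := if_pos hU
  have hβS : β S = cechSign B a (insert a S) • x a ^ (N - K S) • z S := if_neg haS
  have hK : K S ≤ N := Finset.le_sup (Finset.mem_univ S)
  rw [cechTotal_insert x haS, Finset.sum_eq_zero, add_zero, hβS, map_smul, map_smul, hz,
    cechSign_smul_cechSign_smul, smul_smul, ← pow_add, Nat.sub_add_cancel hK]
  intro b hb
  have hab : a ≠ b := fun h => haS (h ▸ hb)
  rw [hβ _ (Finset.mem_erase.2 ⟨hab, S.mem_insert_self a⟩), map_zero, smul_zero]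

theorem exists_pow_smul_eq_zero_of_cechTotal_eq_zero {a : Fin r} {γ : CechFamily x M}
    (hγ : cechTotal x M γ = 0) (hmem : ∀ T, a ∈ T → γ T = 0) : ∃ K : ℕ, x a ^ K • γ = 0 := by
  have hpow (S : Finset (Fin r)) : ∃ K : ℕ, x a ^ K • γ S = 0 := by
    by_cases ha : a ∈ S
    · exact ⟨0, by rw [hmem S ha, smul_zero]⟩
    · have h := congrFun hγ (insert a S)
      rw [cechTotal_insert x ha, Finset.sum_eq_zero, add_zero] at h
      · refine exists_pow_smul_eq_zero_of_cechRes_insert x (a := a) ?_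
        rw [← cechSign_smul_cechSign_smul (B := B) a (insert a S) (cechRes x M _ (γ S)), h,
          Pi.zero_apply, smul_zero]
      · intro b hb
        have hab : a ≠ b := fun h => ha (h ▸ hb)
        rw [hmem _ (Finset.mem_erase.2 ⟨hab, S.mem_insert_self a⟩), map_zero, smul_zero]
  choose K hK using hpow
  exact ⟨Finset.univ.sup K, funext fun S =>
    pow_smul_eq_zero_of_le (Finset.le_sup (Finset.mem_univ S)) (hK S)⟩

theorem exists_cechTotal_eq_pow_smul (a : Fin r) {α : CechFamily x M}
    (hα : cechTotal x M α = 0) :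
    ∃ (K : ℕ) (β : CechFamily x M), cechTotal x M β = x a ^ K • α := by
  obtain ⟨K, β, hβ⟩ := exists_cechTotal_eq_pow_smul_of_mem x a α
  obtain ⟨K', hK'⟩ := exists_pow_smul_eq_zero_of_cechTotal_eq_zero x
    (a := a) (γ := cechTotal x M β - x a ^ K • α)
    (by rw [map_sub, cechTotal_cechTotal, map_smul, hα, smul_zero, sub_zero])
    (fun T ha => sub_eq_zero.2 (hβ T ha))
  exact ⟨K' + K, x a ^ K' • β, by
    rw [map_smul, pow_add, mul_smul, ← sub_eq_zero, ← smul_sub, hK']⟩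

theorem exists_pow_smul_mem_cechBoundaries (a : Fin r) (p : ℕ) (α : Cech x M p)
    (hα : cechDiff x M p α = 0) : ∃ K : ℕ, x a ^ K • α ∈ cechBoundaries x M p := by
  have hext : cechTotal x M (cechExt x α) = 0 := by
    rw [← cechExt_cechDiff, hα]
    funext S
    simp [cechExt]
  obtain ⟨K, β, hβ⟩ := exists_cechTotal_eq_pow_smul x a hext
  have hβα (S : {S : Finset (Fin r) // S.card = p}) : cechTotal x M β S.1 = x a ^ K • α S := by
    rw [hβ, Pi.smul_apply, cechExt_apply]
  refine ⟨K, ?_⟩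
  cases p with
  | zero =>
    refine (Submodule.mem_bot _).2 (funext fun S => (hβα S).symm.trans ?_)
    rw [cechTotal_apply]
    exact Finset.sum_eq_zero fun b hb => by simp [Finset.card_eq_zero.1 S.2] at hb
  | succ p => exact ⟨fun S => β S.1, funext fun T => (cechDiff_restrict x β T).trans (hβα T)⟩

end Cech

/-! ### Functoriality of the Čech complex -/

section CechFunctor

variable {B : Type u} [CommRing B] {r : ℕ} (x : Fin r → B)
  {M : Type*} [AddCommGroup M] [Module B M] {N : Type*} [AddCommGroup N] [Module B N]
  {Q : Type*} [AddCommGroup Q] [Module B Q]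

/-- The map induced on the terms `M_S` of the Čech complex. -/
noncomputable def locMap (f : M →ₗ[B] N) (S : Finset (Fin r)) :
    CechLoc x M S →ₗ[B] CechLoc x N S :=
  IsLocalizedModule.map (cechMonoid x S) (LocalizedModule.mkLinearMap _ M)
    (LocalizedModule.mkLinearMap _ N) f

theorem locMap_mk (f : M →ₗ[B] N) (S : Finset (Fin r)) (m : M) (s : cechMonoid x S) :
    locMap x f S (LocalizedModule.mk m s) = LocalizedModule.mk (f m) s :=
  IsLocalizedModule.map_LocalizedModules _ f m s

theorem cechRes_locMap (f : M →ₗ[B] N) {S T : Finset (Fin r)} (h : S ⊆ T) (y : CechLoc x M S) :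
    cechRes x N h (locMap x f S y) = locMap x f T (cechRes x M h y) := by
  induction y using LocalizedModule.induction_on with
  | h m s => rw [locMap_mk, cechRes_mk, cechRes_mk, locMap_mk]

/-- The map induced on Čech cochains. -/
noncomputable def cechMap (f : M →ₗ[B] N) (p : ℕ) : Cech x M p →ₗ[B] Cech x N p :=
  LinearMap.pi fun S => locMap x f S.1 ∘ₗ LinearMap.proj S

theorem cechMap_apply (f : M →ₗ[B] N) (p : ℕ) (α : Cech x M p)
    (S : {S : Finset (Fin r) // S.card = p}) : cechMap x f p α S = locMap x f S.1 (α S) := rfl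

theorem cechDiff_cechMap (f : M →ₗ[B] N) (p : ℕ) (α : Cech x M p) :
    cechDiff x N p (cechMap x f p α) = cechMap x f (p + 1) (cechDiff x M p α) := by
  have hext (S : Finset (Fin r)) :
      cechExt x (cechMap x f p α) S = locMap x f S (cechExt x α S) := by
    unfold cechExt
    split_ifs
    · rfl
    · rw [map_zero]
  funext T
  rw [cechMap_apply, cechDiff_apply, cechDiff_apply, cechTotal_apply, cechTotal_apply, map_sum]
  refine Finset.sum_congr rfl fun a _ => ?_
  rw [map_smul, ← cechRes_locMap, hext]

theorem cechMap_lsmul (b : B) (p : ℕ) (α : Cech x M p) :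
    cechMap x (LinearMap.lsmul B M b) p α = b • α := by
  funext S
  rw [cechMap_apply, Pi.smul_apply]
  induction α S using LocalizedModule.induction_on with
  | h m s => rw [locMap_mk, LocalizedModule.smul'_mk, LinearMap.lsmul_apply]

theorem cechMap_injective {f : M →ₗ[B] N} (hf : Function.Injective f) (p : ℕ) :
    Function.Injective (cechMap x f p) := fun _ _ h =>
  funext fun S => IsLocalizedModule.map_injective _ _ _ f hf (congrFun h S)

theorem cechMap_surjective {f : M →ₗ[B] N} (hf : Function.Surjective f) (p : ℕ) :
    Function.Surjective (cechMap x f p) := fun β => by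
  have hsurj (S : Finset (Fin r)) : Function.Surjective (locMap x f S) :=
    IsLocalizedModule.map_surjective _ _ _ f hf
  choose α hα using fun S : {S : Finset (Fin r) // S.card = p} => hsurj S.1 (β S)
  exact ⟨α, funext hα⟩

theorem cechMap_exact {f : M →ₗ[B] N} {g : N →ₗ[B] Q} (h : Function.Exact f g) (p : ℕ) :
    Function.Exact (cechMap x f p) (cechMap x g p) := by
  have hexact (S : Finset (Fin r)) : Function.Exact (locMap x f S) (locMap x g S) :=
    IsLocalizedModule.map_exact _ _ _ _ f g h
  refine fun β => ⟨fun hβ => ?_, ?_⟩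
  · choose α hα using fun S : {S : Finset (Fin r) // S.card = p} =>
      (hexact S.1 (β S)).1 (congrFun hβ S)
    exact ⟨α, funext hα⟩
  · rintro ⟨α, rfl⟩
    exact funext fun S => (hexact S.1 _).2 ⟨α S, rfl⟩

theorem cechMap_mem_cechBoundaries (f : M →ₗ[B] N) {p : ℕ} {α : Cech x M p}
    (hα : α ∈ cechBoundaries x M p) : cechMap x f p α ∈ cechBoundaries x N p := by
  cases p with
  | zero => rw [(Submodule.mem_bot _).1 hα, map_zero]; exact zero_mem _
  | succ p =>
    obtain ⟨β, rfl⟩ := hα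
    exact ⟨cechMap x f p β, cechDiff_cechMap x f p β⟩

theorem map_cechBoundaries_of_surjective {g : N →ₗ[B] Q} (hg : Function.Surjective g) (p : ℕ) :
    (cechBoundaries x N p).map (cechMap x g p) = cechBoundaries x Q p := by
  refine le_antisymm (Submodule.map_le_iff_le_comap.2 fun β hβ =>
    cechMap_mem_cechBoundaries x g hβ) ?_
  cases p with
  | zero => exact bot_le
  | succ p =>
    rintro _ ⟨η, rfl⟩
    obtain ⟨ξ, rfl⟩ := cechMap_surjective x hg p η
    exact ⟨cechDiff x N p ξ, ⟨ξ, rfl⟩, (cechDiff_cechMap x g p ξ).symm⟩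

theorem exists_sub_mem_cechBoundaries {f : M →ₗ[B] N} {g : N →ₗ[B] Q}
    (hg : Function.Surjective g) (h : Function.Exact f g) {p : ℕ} {β : Cech x N p}
    (hβ : cechMap x g p β ∈ cechBoundaries x Q p) :
    ∃ α, β - cechMap x f p α ∈ cechBoundaries x N p := by
  rw [← map_cechBoundaries_of_surjective x hg] at hβ
  obtain ⟨γ, hγ, hγβ⟩ := hβ
  obtain ⟨α, hα⟩ := (cechMap_exact x h p (β - γ)).1 (by rw [map_sub, hγβ, sub_self])
  exact ⟨α, by rwa [hα, sub_sub_cancel]⟩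

theorem mem_cechBoundaries_of_connecting {f : M →ₗ[B] N} {g : N →ₗ[B] Q}
    (hf : Function.Injective f) (hg : Function.Surjective g) (h : Function.Exact f g) {p : ℕ}
    {α : Cech x M (p + 1)} {β : Cech x N p} (hβ : cechDiff x N p β = cechMap x f (p + 1) α)
    (hgβ : cechMap x g p β ∈ cechBoundaries x Q p) : α ∈ cechBoundaries x M (p + 1) := by
  obtain ⟨ε, hε⟩ := exists_sub_mem_cechBoundaries x hg h hgβ
  refine ⟨ε, cechMap_injective x hf _ ?_⟩
  have hcycle := cechBoundaries_le_ker x p hε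
  rw [LinearMap.mem_ker, map_sub, sub_eq_zero, hβ] at hcycle
  rw [← cechDiff_cechMap, hcycle]

theorem subsingleton_locCoh_iff {p : ℕ} : Subsingleton (LocCoh x M p) ↔
    ∀ α, cechDiff x M p α = 0 → α ∈ cechBoundaries x M p := by
  rw [Submodule.Quotient.subsingleton_iff, Submodule.submoduleOf_eq_top]
  rfl

theorem subsingleton_locCoh_of_exact {f : M →ₗ[B] N} {g : N →ₗ[B] Q}
    (hf : Function.Injective f) (hg : Function.Surjective g) (h : Function.Exact f g) {p : ℕ}
    (hM : Subsingleton (LocCoh x M p)) (hQ : Subsingleton (LocCoh x Q p)) :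
    Subsingleton (LocCoh x N p) := by
  rw [subsingleton_locCoh_iff] at hM hQ ⊢
  intro β hβ
  obtain ⟨α, hα⟩ := exists_sub_mem_cechBoundaries x hg h
    (hQ (cechMap x g p β) (by rw [cechDiff_cechMap, hβ, map_zero]))
  have hcycle := cechBoundaries_le_ker x p hα
  rw [LinearMap.mem_ker, map_sub, hβ, zero_sub, neg_eq_zero, cechDiff_cechMap,
    map_eq_zero_iff _ (cechMap_injective x hf _)] at hcycle
  exact (Submodule.sub_mem_iff_left _ (cechMap_mem_cechBoundaries x f (hM α hcycle))).1 hα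

theorem subsingleton_locCoh_of_linearEquiv (e : M ≃ₗ[B] N) {p : ℕ}
    (hN : Subsingleton (LocCoh x N p)) : Subsingleton (LocCoh x M p) := by
  rw [subsingleton_locCoh_iff] at hN ⊢
  intro α hα
  have h := hN (cechMap x e.toLinearMap p α) (by rw [cechDiff_cechMap, hα, map_zero])
  rw [← map_cechBoundaries_of_surjective x (g := e.toLinearMap) e.surjective] at h
  obtain ⟨α', hα', heq⟩ := h
  rwa [← cechMap_injective x (f := e.toLinearMap) e.injective p heq]

theorem subsingleton_cechLoc {S : Finset (Fin r)} {a : Fin r} (ha : a ∈ S)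
    (h : ∀ m : M, ∃ K : ℕ, x a ^ K • m = 0) : Subsingleton (CechLoc x M S) :=
  LocalizedModule.subsingleton_iff.2 fun m =>
    let ⟨K, hK⟩ := h m
    ⟨x a ^ K, pow_mem (mem_cechMonoid x ha) K, hK⟩

theorem subsingleton_cech_succ (h : ∀ (a : Fin r) (m : M), ∃ K : ℕ, x a ^ K • m = 0) (p : ℕ) :
    Subsingleton (Cech x M (p + 1)) := by
  have (S : {S : Finset (Fin r) // S.card = p + 1}) : Subsingleton (CechLoc x M S.1) := by
    obtain ⟨a, ha⟩ := Finset.card_pos.1 (S.2.symm ▸ Nat.succ_pos p : 0 < S.1.card)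
    exact subsingleton_cechLoc x ha (h a)
  exact Pi.instSubsingleton

theorem subsingleton_locCoh_of_subsingleton_cech {p : ℕ} [Subsingleton (Cech x M p)] :
    Subsingleton (LocCoh x M p) :=
  (subsingleton_locCoh_iff x).2 fun α _ => Subsingleton.elim 0 α ▸ zero_mem _

theorem subsingleton_locCoh_of_subsingleton [Subsingleton M] (p : ℕ) :
    Subsingleton (LocCoh x M p) := by
  have (S : {S : Finset (Fin r) // S.card = p}) : Subsingleton (CechLoc x M S.1) :=
    IsLocalizedModule.subsingleton_of_subsingleton (cechMonoid x S.1)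
      (LocalizedModule.mkLinearMap _ M)
  have : Subsingleton (Cech x M p) := Pi.instSubsingleton
  exact subsingleton_locCoh_of_subsingleton_cech x

theorem subsingleton_locCoh_of_fg {p : ℕ}
    (h : ∀ M' : Submodule B M, M'.FG → Subsingleton (LocCoh x M' p)) :
    Subsingleton (LocCoh x M p) := by
  rw [subsingleton_locCoh_iff]
  intro α hα
  choose m s hms using fun S => LocalizedModule.induction_on
    (β := fun y => ∃ m s, y = LocalizedModule.mk m s) (fun m s => ⟨m, s, rfl⟩) (α S)
  let M' := Submodule.span B (Set.range m)
  let β : Cech x M' p := fun S =>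
    LocalizedModule.mk ⟨m S, Submodule.subset_span ⟨S, rfl⟩⟩ (s S)
  have hβ : cechMap x M'.subtype p β = α := funext fun S => by
    rw [cechMap_apply, locMap_mk, hms]; rfl
  rw [← hβ]
  refine cechMap_mem_cechBoundaries x _ ((subsingleton_locCoh_iff x).1
    (h M' (Submodule.fg_span (Set.finite_range m))) β ?_)
  apply cechMap_injective x M'.subtype_injective
  rw [← cechDiff_cechMap, hβ, hα, map_zero]

/-! ### Vanishing above the dimension -/

theorem mem_cechBoundaries_of_smul_mem {a : Fin r} {g : M →ₗ[B] Q}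
    (ha : Function.Injective (LinearMap.lsmul B M (x a))) (hg : Function.Surjective g)
    (h : Function.Exact (LinearMap.lsmul B M (x a)) g) {p : ℕ}
    (hQ : Subsingleton (LocCoh x Q p)) {α : Cech x M (p + 1)}
    (hα : x a • α ∈ cechBoundaries x M (p + 1)) : α ∈ cechBoundaries x M (p + 1) := by
  obtain ⟨β, hβ⟩ := hα
  have hβ' : cechDiff x M p β = cechMap x (LinearMap.lsmul B M (x a)) (p + 1) α := by
    rw [cechMap_lsmul]; exact hβ
  refine mem_cechBoundaries_of_connecting x ha hg h hβ' ((subsingleton_locCoh_iff x).1 hQ _ ?_)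
  rw [cechDiff_cechMap, hβ']
  exact (cechMap_exact x h (p + 1)).apply_apply_eq_zero α

theorem subsingleton_locCoh_succ {a : Fin r} {g : M →ₗ[B] Q}
    (ha : Function.Injective (LinearMap.lsmul B M (x a))) (hg : Function.Surjective g)
    (h : Function.Exact (LinearMap.lsmul B M (x a)) g) {p : ℕ}
    (hQ : Subsingleton (LocCoh x Q p)) : Subsingleton (LocCoh x M (p + 1)) := by
  rw [subsingleton_locCoh_iff]
  intro α hα
  obtain ⟨K, hK⟩ := exists_pow_smul_mem_cechBoundaries x a (p + 1) α hα
  induction K with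
  | zero => rwa [pow_zero, one_smul] at hK
  | succ K ihK =>
    refine ihK (mem_cechBoundaries_of_smul_mem x ha hg h hQ ?_)
    rwa [smul_smul, ← pow_succ']

theorem exact_lsmul_factor (I : Ideal B) (b : B) :
    Function.Exact (LinearMap.lsmul B (B ⧸ I) b)
      (Submodule.factor (le_sup_left : I ≤ I ⊔ Ideal.span {b})) := by
  intro m
  obtain ⟨c, rfl⟩ := Ideal.Quotient.mk_surjective m
  change Ideal.Quotient.mk (I ⊔ Ideal.span {b}) c = 0 ↔ _
  rw [Ideal.Quotient.eq_zero_iff_mem, Submodule.mem_sup]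
  constructor
  · rintro ⟨q, hq, z, hz, rfl⟩
    obtain ⟨t, rfl⟩ := Ideal.mem_span_singleton'.1 hz
    refine ⟨Ideal.Quotient.mk I t, (Ideal.Quotient.eq.2 ?_ : Ideal.Quotient.mk I (b * t) = _)⟩
    rw [mul_comm, sub_add_cancel_right]
    exact neg_mem hq
  · rintro ⟨t, ht⟩
    obtain ⟨t, rfl⟩ := Ideal.Quotient.mk_surjective t
    have hmem : c - b * t ∈ I := Ideal.Quotient.eq.1 ht.symm
    exact ⟨_, hmem, b * t, Ideal.mul_mem_right _ _ (Ideal.mem_span_singleton_self _),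
      sub_add_cancel _ _⟩

theorem subsingleton_locCoh_quotient_prime (P : Ideal B) [P.IsPrime] (p : ℕ)
    (ih : ∀ J : Ideal B, ringKrullDim (B ⧸ J) < p → Subsingleton (LocCoh x (B ⧸ J) p))
    (hP : ringKrullDim (B ⧸ P) < (p + 1 : ℕ)) : Subsingleton (LocCoh x (B ⧸ P) (p + 1)) := by
  by_cases hx : ∀ a, x a ∈ P
  · have : Subsingleton (Cech x (B ⧸ P) (p + 1)) := by
      refine subsingleton_cech_succ x (fun a m => ⟨1, ?_⟩) p
      obtain ⟨b, rfl⟩ := Ideal.Quotient.mk_surjective m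
      rw [pow_one]
      exact Ideal.Quotient.eq_zero_iff_mem.2 (Ideal.mul_mem_right b P (hx a))
    exact subsingleton_locCoh_of_subsingleton_cech x
  · push Not at hx
    obtain ⟨a, ha⟩ := hx
    have hne : Ideal.Quotient.mk P (x a) ≠ 0 := fun h => ha (Ideal.Quotient.eq_zero_iff_mem.1 h)
    have hinj : Function.Injective (LinearMap.lsmul B (B ⧸ P) (x a)) := fun _ _ h =>
      mul_left_cancel₀ hne h
    have hle : P ≤ P ⊔ Ideal.span {x a} := le_sup_left
    have hdim : ringKrullDim (B ⧸ P ⊔ Ideal.span {x a}) + 1 < (p : WithBot ℕ∞) + 1 :=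
      (ringKrullDim_succ_le_of_surjective (Ideal.Quotient.factor hle)
        (Ideal.Quotient.factor_surjective hle) (mem_nonZeroDivisors_of_ne_zero hne)
        (Ideal.Quotient.eq_zero_iff_mem.2
          (Ideal.mem_sup_right (Ideal.mem_span_singleton_self _)))).trans_lt hP
    exact subsingleton_locCoh_succ x hinj (Submodule.factor_surjective hle)
      (exact_lsmul_factor P (x a)) (ih _ (lt_of_add_lt_add_right hdim))

theorem subsingleton_of_supportDim_lt_zero (h : Module.supportDim B M < 0) : Subsingleton M := by
  by_contra hM
  rw [not_subsingleton_iff_nontrivial] at hM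
  have : Nonempty (Module.support B M) := (Module.nonempty_support_iff (R := B)).2 hM |>.to_subtype
  exact h.not_ge Order.krullDim_nonneg

theorem subsingleton_locCoh_succ_of_finite [IsNoetherianRing B] {p : ℕ}
    (ih : ∀ J : Ideal B, ringKrullDim (B ⧸ J) < p → Subsingleton (LocCoh x (B ⧸ J) p))
    (hfin : Module.Finite B M) (h : Module.supportDim B M < (p + 1 : ℕ)) :
    Subsingleton (LocCoh x M (p + 1)) := by
  revert h
  refine IsNoetherianRing.induction_on_isQuotientEquivQuotientPrime (A := B) hfin
    (motive := fun N _ _ _ =>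
      Module.supportDim B N < (p + 1 : ℕ) → Subsingleton (LocCoh x N (p + 1))) ?_ ?_ ?_
  · intro N _ _ _ _ _
    exact subsingleton_locCoh_of_subsingleton x (p + 1)
  · intro N _ _ _ P e h
    rw [Module.supportDim_eq_of_equiv e, Module.supportDim_quotient_eq_ringKrullDim] at h
    exact subsingleton_locCoh_of_linearEquiv x e (subsingleton_locCoh_quotient_prime x P.1 p ih h)
  · intro N₁ _ _ _ N₂ _ _ _ N₃ _ _ _ f g hf hg hfg h₁ h₃ h
    exact subsingleton_locCoh_of_exact x hf hg hfg
      (h₁ ((Module.supportDim_le_of_injective f hf).trans_lt h))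
      (h₃ ((Module.supportDim_le_of_surjective g hg).trans_lt h))

theorem subsingleton_locCoh_quotient [IsNoetherianRing B] (p : ℕ) (J : Ideal B)
    (h : ringKrullDim (B ⧸ J) < p) : Subsingleton (LocCoh x (B ⧸ J) p) := by
  induction p generalizing J with
  | zero =>
    rw [← Module.supportDim_quotient_eq_ringKrullDim] at h
    have := subsingleton_of_supportDim_lt_zero h
    exact subsingleton_locCoh_of_subsingleton x 0
  | succ p ih =>
    rw [← Module.supportDim_quotient_eq_ringKrullDim] at h
    exact subsingleton_locCoh_succ_of_finite x ih inferInstance h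

theorem subsingleton_locCoh_of_ringKrullDim_lt [IsNoetherianRing B] {p : ℕ}
    (h : ringKrullDim B < p) : Subsingleton (LocCoh x M p) := by
  refine subsingleton_locCoh_of_fg x fun M' hM' => ?_
  have hdim : Module.supportDim B M' < p := (Module.supportDim_le_ringKrullDim B M').trans_lt h
  cases p with
  | zero =>
    have := subsingleton_of_supportDim_lt_zero hdim
    exact subsingleton_locCoh_of_subsingleton x 0
  | succ p =>
    exact subsingleton_locCoh_succ_of_finite x (subsingleton_locCoh_quotient x p)
      (Module.Finite.iff_fg.2 hM') hdim

end CechFunctor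

/-! ### The grading of the Čech complex -/

section CechGrading

variable {k : Type w} [Field k] {B : Type u} [CommRing B] [Algebra k B]
  (𝒜 : ℤ → Submodule k B) [GradedAlgebra 𝒜] {r : ℕ} {x : Fin r → B}
  {M : Type*} [AddCommGroup M] [Module B M] (ℳ : ℤ → AddSubgroup M) [SetLike.GradedSMul 𝒜 ℳ]
  {N : Type*} [AddCommGroup N] [Module B N] (𝒩 : ℤ → AddSubgroup N) [SetLike.GradedSMul 𝒜 𝒩]

theorem exists_degree_of_mem_cechMonoid (hx : ∀ a, ∃ d : ℤ, x a ∈ 𝒜 d) {S : Finset (Fin r)}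
    {s : B} (hs : s ∈ cechMonoid x S) : ∃ d : ℤ, s ∈ 𝒜 d := by
  have hle : cechMonoid x S ≤ SetLike.homogeneousSubmonoid 𝒜 := by
    rw [cechMonoid, Submonoid.closure_le]
    rintro _ ⟨a, -, rfl⟩
    exact hx a
  exact hle hs

theorem mk_mem_locGrading {S : Finset (Fin r)} {a d e : ℤ} {m : M} {s : cechMonoid x S}
    (hs : (s : B) ∈ 𝒜 a) (hm : m ∈ ℳ e) (h : e = a + d) :
    LocalizedModule.mk m s ∈ locGrading x 𝒜 ℳ S d :=
  ⟨a, m, s, hs, h ▸ hm, rfl⟩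

theorem exists_common_denominator {S : Finset (Fin r)} (T : Finset ℤ) (c : ℤ → CechLoc x M S)
    (hc : ∀ d ∈ T, c d ∈ locGrading x 𝒜 ℳ S d) :
    ∃ (a : ℤ) (s : cechMonoid x S), (s : B) ∈ 𝒜 a ∧
      ∃ m : ℤ → M, ∀ d ∈ T, m d ∈ ℳ (a + d) ∧ c d = LocalizedModule.mk (m d) s := by
  induction T using Finset.induction_on with
  | empty => exact ⟨0, 1, SetLike.GradedOne.one_mem, fun _ => 0, by simp⟩
  | insert e T he ih =>
    obtain ⟨a, s, hs, m, hm⟩ := ih fun d hd => hc d (Finset.mem_insert_of_mem hd)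
    obtain ⟨b, n, t, ht, hn, hce⟩ := hc e (Finset.mem_insert_self e T)
    refine ⟨a + b, s * t, SetLike.GradedMul.mul_mem hs ht,
      fun d => if d = e then (s : B) • n else (t : B) • m d, fun d hd => ?_⟩
    dsimp only
    split_ifs with h
    · subst h
      rw [add_assoc, hce]
      exact ⟨grSmul_mem 𝒜 ℳ hs hn, (LocalizedModule.mk_cancel_common_left s t n).symm⟩
    · obtain ⟨hmd, hcd⟩ := hm d (Finset.mem_of_mem_insert_of_ne hd h)
      rw [add_comm a b, add_assoc, hcd]
      exact ⟨grSmul_mem 𝒜 ℳ ht hmd, (LocalizedModule.mk_cancel_common_right s t (m d)).symm⟩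

/-- The map `m ↦ m / s`. -/
noncomputable def mkDiv {S : Submonoid B} (s : S) : M →ₗ[B] LocalizedModule S M :=
  LocalizedModule.divBy s ∘ₗ LocalizedModule.mkLinearMap S M

theorem mkDiv_apply {S : Submonoid B} (s : S) (m : M) : mkDiv s m = LocalizedModule.mk m s := by
  rw [mkDiv, LinearMap.comp_apply, LocalizedModule.mkLinearMap_apply, LocalizedModule.divBy_apply,
    LocalizedModule.liftOn_mk, one_mul]

theorem mkDiv_eq_zero_iff {S : Submonoid B} (s : S) (m : M) :
    mkDiv s m = 0 ↔ ∃ t : S, t • m = 0 := by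
  rw [mkDiv_apply, IsLocalizedModule.mk_eq_mk', IsLocalizedModule.mk'_eq_zero']

theorem isInternal_locGrading (hx : ∀ a, ∃ d : ℤ, x a ∈ 𝒜 d) (h : IsInternal ℳ)
    (S : Finset (Fin r)) : IsInternal (locGrading x 𝒜 ℳ S) := by
  refine isInternal_of_iSup_eq_top_of_sum_eq_zero (eq_top_iff.2 fun y _ => ?_)
    fun T c hc h0 d hd => ?_
  · induction y using LocalizedModule.induction_on with
    | h m s =>
      obtain ⟨a, ha⟩ := exists_degree_of_mem_cechMonoid 𝒜 hx s.2
      rw [← mkDiv_apply]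
      refine map_mem_of_isInternal h (mkDiv s).toAddMonoidHom (fun d z hz => ?_) m
      exact AddSubgroup.mem_iSup_of_mem (d - a) (mkDiv_apply s z ▸
        mk_mem_locGrading 𝒜 ℳ ha hz (add_sub_cancel a d).symm)
  · obtain ⟨a, s, -, m, hm⟩ := exists_common_denominator 𝒜 ℳ T c hc
    have hcm (d : ℤ) (hd : d ∈ T) : c d = mkDiv s (m d) := by rw [(hm d hd).2, mkDiv_apply]
    rw [Finset.sum_congr rfl hcm, ← map_sum, mkDiv_eq_zero_iff] at h0
    obtain ⟨t, ht⟩ := h0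
    obtain ⟨b, hb⟩ := exists_degree_of_mem_cechMonoid 𝒜 hx t.2
    rw [hcm d hd, mkDiv_eq_zero_iff]
    refine ⟨t, eq_zero_of_sum_eq_zero (isInternal_comp_equiv h (Equiv.addLeft (b + a)))
      (c := fun d => t • m d) (fun d hd => ?_) (Finset.smul_sum.symm.trans ht) d hd⟩
    have hmem := grSmul_mem 𝒜 ℳ hb (hm d hd).1
    rwa [← add_assoc] at hmem

theorem mem_cechGrading {p : ℕ} {d : ℤ} {α : Cech x M p} :
    α ∈ cechGrading x 𝒜 ℳ p d ↔ ∀ S, α S ∈ locGrading x 𝒜 ℳ S.1 d := by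
  simp [cechGrading, AddSubgroup.mem_pi]

theorem isInternal_cechGrading (hx : ∀ a, ∃ d : ℤ, x a ∈ 𝒜 d) (h : IsInternal ℳ) (p : ℕ) :
    IsInternal (cechGrading x 𝒜 ℳ p) :=
  isInternal_pi fun S => isInternal_locGrading 𝒜 ℳ hx h S.1

theorem locGrading_smul {S : Finset (Fin r)} {a d : ℤ} {b : B} (hb : b ∈ 𝒜 a)
    {y : CechLoc x M S} (hy : y ∈ locGrading x 𝒜 ℳ S d) : b • y ∈ locGrading x 𝒜 ℳ S (a + d) := by
  obtain ⟨c, m, s, hs, hm, rfl⟩ := hy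
  rw [LocalizedModule.smul'_mk]
  exact mk_mem_locGrading 𝒜 ℳ hs (grSmul_mem 𝒜 ℳ hb hm) (add_left_comm a c d)

instance gradedSMul_cechGrading (p : ℕ) : SetLike.GradedSMul 𝒜 (cechGrading x 𝒜 ℳ p) where
  smul_mem := fun _ _ _ _ hb hα => (mem_cechGrading 𝒜 ℳ).2 fun S =>
    locGrading_smul 𝒜 ℳ hb ((mem_cechGrading 𝒜 ℳ).1 hα S)

theorem cechRes_mem_locGrading {S T : Finset (Fin r)} (h : S ⊆ T) {d : ℤ} {y : CechLoc x M S}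
    (hy : y ∈ locGrading x 𝒜 ℳ S d) : cechRes x M h y ∈ locGrading x 𝒜 ℳ T d := by
  obtain ⟨c, m, s, hs, hm, rfl⟩ := hy
  rw [cechRes_mk]
  exact ⟨c, m, ⟨s.1, _⟩, hs, hm, rfl⟩

theorem cechDiff_mem_cechGrading {p : ℕ} {d : ℤ} {α : Cech x M p}
    (hα : α ∈ cechGrading x 𝒜 ℳ p d) : cechDiff x M p α ∈ cechGrading x 𝒜 ℳ (p + 1) d := by
  rw [mem_cechGrading] at hα ⊢
  intro T
  rw [cechDiff_apply, cechTotal_apply]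
  refine sum_mem fun a _ => ?_
  have hmem : cechRes x M (T.1.erase_subset a) (cechExt x α (T.1.erase a)) ∈
      locGrading x 𝒜 ℳ T.1 d := by
    refine cechRes_mem_locGrading 𝒜 ℳ _ ?_
    rw [cechExt]
    split_ifs with h
    · exact hα ⟨_, h⟩
    · exact zero_mem _
  rw [cechSign]
  rcases neg_one_pow_eq_or B (T.1.filter (· < a)).card with e | e <;> rw [e]
  · rwa [one_smul]
  · rw [neg_one_smul]
    exact neg_mem hmem

theorem cechMap_mem_cechGrading {f : M →ₗ[B] N} (hf : ∀ d, ∀ m ∈ ℳ d, f m ∈ 𝒩 d) {p : ℕ} {d : ℤ}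
    {α : Cech x M p} (hα : α ∈ cechGrading x 𝒜 ℳ p d) :
    cechMap x f p α ∈ cechGrading x 𝒜 𝒩 p d := by
  rw [mem_cechGrading] at hα ⊢
  intro S
  obtain ⟨a, m, s, hs, hm, h⟩ := hα S
  rw [cechMap_apply, h, locMap_mk]
  exact ⟨a, f m, s, hs, hf _ _ hm, rfl⟩

/-- The grading of `H^p_𝔪(M)` induced by the grading of the Čech complex. -/
noncomputable abbrev locCohGrading (x : Fin r → B) (p : ℕ) (e : ℤ) : AddSubgroup (LocCoh x M p) :=
  subquotGrading (cechGrading x 𝒜 ℳ p) (LinearMap.ker (cechDiff x M p)) (cechBoundaries x M p) e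

end CechGrading

/-! ### Free modules with coefficients -/

section CoefMap

variable {B : Type u} [CommRing B] {ι κ μ : Type*}
  {X : Type*} [AddCommGroup X] [Module B X] {Y : Type*} [AddCommGroup Y] [Module B Y]

open Classical in
/-- The functor `- ⊗ X` on maps between free modules, where `B^(ι) ⊗ X` is written as `ι →₀ X`. -/
noncomputable def coefMap (X : Type*) [AddCommGroup X] [Module B X] :
    ((ι →₀ B) →ₗ[B] (κ →₀ B)) →ₗ[B] (ι →₀ X) →ₗ[B] (κ →₀ X) :=
  ((TensorProduct.finsuppScalarLeft B X ι).arrowCongr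
    (TensorProduct.finsuppScalarLeft B X κ)).toLinearMap ∘ₗ LinearMap.rTensorHom X

theorem coefMap_single (φ : (ι →₀ B) →ₗ[B] (κ →₀ B)) (t : ι) (y : X) (s : κ) :
    coefMap X φ (Finsupp.single t y) s = φ (Finsupp.single t 1) s • y := by
  simp [coefMap, LinearEquiv.arrowCongr_apply, TensorProduct.finsuppScalarLeft_apply_tmul_apply]

theorem coefMap_apply (φ : (ι →₀ B) →ₗ[B] (κ →₀ B)) (y : ι →₀ X) (s : κ) :
    coefMap X φ y s = ∑ t ∈ y.support, φ (Finsupp.single t 1) s • y t := by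
  conv_lhs => rw [← Finsupp.sum_single y, Finsupp.sum, map_sum, Finsupp.finsetSum_apply]
  simp only [coefMap_single]

theorem coefMap_comp (φ : (ι →₀ B) →ₗ[B] (κ →₀ B)) (ψ : (κ →₀ B) →ₗ[B] (μ →₀ B)) :
    coefMap X (ψ ∘ₗ φ) = coefMap X ψ ∘ₗ coefMap X φ := by
  classical
  simp [coefMap, LinearMap.rTensor_comp, ← LinearEquiv.arrowCongr_comp _
    (TensorProduct.finsuppScalarLeft B X κ)]

theorem coefMap_coefMap (φ : (ι →₀ B) →ₗ[B] (κ →₀ B)) (ψ : (κ →₀ B) →ₗ[B] (μ →₀ B)) (y : ι →₀ X) :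
    coefMap X ψ (coefMap X φ y) = coefMap X (ψ ∘ₗ φ) y := by
  rw [coefMap_comp, LinearMap.comp_apply]

theorem coefMap_sub (φ ψ : (ι →₀ B) →ₗ[B] (κ →₀ B)) (y : ι →₀ X) :
    coefMap X (φ - ψ) y = coefMap X φ y - coefMap X ψ y :=
  LinearMap.congr_fun (map_sub (coefMap X) φ ψ) y

theorem coefMap_id : coefMap X (LinearMap.id : (ι →₀ B) →ₗ[B] (ι →₀ B)) = LinearMap.id := by
  ext1 y
  simp [coefMap, LinearEquiv.arrowCongr]

theorem mapRange_coefMap (f : X →ₗ[B] Y) (φ : (ι →₀ B) →ₗ[B] (κ →₀ B)) (y : ι →₀ X) :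
    Finsupp.mapRange.linearMap f (coefMap X φ y) =
      coefMap Y φ (Finsupp.mapRange.linearMap f y) := by
  rw [← LinearMap.comp_apply, ← LinearMap.comp_apply]
  congr 1
  ext t y s
  simp [coefMap_single]

end CoefMap

/-! ### Graded maps between graded free modules -/

section GradedMaps

variable {k : Type w} [Field k] {B : Type u} [CommRing B] [Algebra k B]
  {𝒜 : ℤ → Submodule k B} {ι : Type*}
  {X : Type*} [AddCommGroup X] [Module B X] (gr : ℤ → AddSubgroup X) [SetLike.GradedSMul 𝒜 gr]

instance gradedSMul_self [GradedAlgebra 𝒜] :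
    SetLike.GradedSMul 𝒜 (fun d => (𝒜 d).toAddSubgroup) where
  smul_mem := fun _ _ _ _ hb hm => SetLike.GradedMul.mul_mem hb hm

instance gradedSMul_finGrading (deg : ι → ℤ) : SetLike.GradedSMul 𝒜 (finGrading deg gr) where
  smul_mem := fun a d b y hb hy s => by
    have hmem := grSmul_mem 𝒜 gr hb (hy s)
    rwa [← add_sub_assoc] at hmem

instance gradedSMul_freeGrading [GradedAlgebra 𝒜] {ι : Type u} (deg : ι → ℤ) :
    SetLike.GradedSMul 𝒜 (freeGrading 𝒜 deg) :=
  gradedSMul_finGrading (fun d => (𝒜 d).toAddSubgroup) deg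

theorem isInternal_freeGrading [GradedAlgebra 𝒜] {ι : Type u} (deg : ι → ℤ) :
    IsInternal (freeGrading 𝒜 deg) :=
  isInternal_finGrading deg (isInternal_toAddSubgroup 𝒜)

theorem map_mem_of_single_mem {ι : Type u} {deg : ι → ℤ} {φ : (ι →₀ B) →ₗ[B] X}
    (hφ : ∀ t, φ (Finsupp.single t 1) ∈ gr (deg t)) {e : ℤ} {y : ι →₀ B}
    (hy : y ∈ freeGrading 𝒜 deg e) : φ y ∈ gr e := by
  rw [← Finsupp.sum_single y, Finsupp.sum, map_sum]
  refine sum_mem fun t _ => ?_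
  have hmem := grSmul_mem 𝒜 gr (hy t) (hφ t)
  rwa [← map_smul, Finsupp.smul_single_one, sub_add_cancel] at hmem

variable (𝒜) in
/-- A linear map between graded free modules which preserves degrees. -/
def IsGradedMap {ι κ : Type u} (deg : ι → ℤ) (deg' : κ → ℤ) (φ : (ι →₀ B) →ₗ[B] (κ →₀ B)) :
    Prop :=
  ∀ t, φ (Finsupp.single t 1) ∈ freeGrading 𝒜 deg' (deg t)

section IsGradedMap

variable {ι κ : Type u} {deg : ι → ℤ} {deg' : κ → ℤ} {φ : (ι →₀ B) →ₗ[B] (κ →₀ B)}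

theorem IsGradedMap.map_mem [GradedAlgebra 𝒜] (hφ : IsGradedMap 𝒜 deg deg' φ) {e : ℤ}
    {y : ι →₀ B} (hy : y ∈ freeGrading 𝒜 deg e) : φ y ∈ freeGrading 𝒜 deg' e :=
  map_mem_of_single_mem (freeGrading 𝒜 deg') hφ hy

theorem IsGradedMap.exists_homogeneous_eq [GradedAlgebra 𝒜] (hφ : IsGradedMap 𝒜 deg deg' φ) {e : ℤ}
    {y : ι →₀ B} (hy : φ y ∈ freeGrading 𝒜 deg' e) : ∃ z ∈ freeGrading 𝒜 deg e, φ z = φ y :=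
  exists_homogeneous_preimage (gr := freeGrading 𝒜 deg) (gr' := freeGrading 𝒜 deg')
    (isInternal_freeGrading deg) (isInternal_freeGrading deg') φ.toAddMonoidHom
    (fun _ _ hz => hφ.map_mem hz) hy

theorem IsGradedMap.coefMap_mem (hφ : IsGradedMap 𝒜 deg deg' φ) {e : ℤ} {y : ι →₀ X}
    (hy : y ∈ finGrading deg gr e) : coefMap X φ y ∈ finGrading deg' gr e := by
  intro s
  rw [coefMap_apply]
  refine sum_mem fun t _ => ?_
  have hmem := grSmul_mem 𝒜 gr (hφ t s) (hy t)
  rwa [sub_add_sub_cancel'] at hmem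

theorem IsGradedMap.exists_homogeneous_coefMap_eq (hφ : IsGradedMap 𝒜 deg deg' φ)
    (h : IsInternal gr) {e : ℤ} {y : ι →₀ X}
    (hy : coefMap X φ y ∈ finGrading deg' gr e) :
    ∃ z ∈ finGrading deg gr e, coefMap X φ z = coefMap X φ y :=
  exists_homogeneous_preimage (isInternal_finGrading deg h) (isInternal_finGrading deg' h)
    (coefMap X φ).toAddMonoidHom (fun _ _ hz => hφ.coefMap_mem gr hz) hy

end IsGradedMap

end GradedMaps

/-! ### Graded free resolutions -/

section FreeRes

variable {k : Type w} [Field k] {B : Type u} [CommRing B] [Algebra k B]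

/-- A graded free resolution of `B / I`. The free module in homological degree `p` has the index
`p + 1`; the free module with the index `0` is zero, so that `Tor_0` needs no special treatment. -/
structure FreeRes (𝒜 : ℤ → Submodule k B) (I : Ideal B) where
  ι : ℕ → Type u
  deg : ∀ p, ι p → ℤ
  d : ∀ p, (ι (p + 1) →₀ B) →ₗ[B] (ι p →₀ B)
  aug : (ι 1 →₀ B) →ₗ[B] B ⧸ I
  isEmpty_zero : IsEmpty (ι 0)
  isGradedMap_d : ∀ p, IsGradedMap 𝒜 (deg (p + 1)) (deg p) (d p)
  aug_mem : ∀ t, aug (Finsupp.single t 1) ∈ quotientGrading 𝒜 I (deg 1 t)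
  aug_lift : ∀ e, ∀ b ∈ quotientGrading 𝒜 I e, ∃ y ∈ freeGrading 𝒜 (deg 1) e, aug y = b
  exact_aug : Function.Exact (d 1) aug
  exact_d : ∀ p, Function.Exact (d (p + 2)) (d (p + 1))

theorem exists_seq {α : ℕ → Type*} {P : ∀ p, α p → Prop} {R : ∀ p, α p → α (p + 1) → Prop}
    (a : α 0) (ha : P 0 a) (h : ∀ p b, P p b → ∃ c, P (p + 1) c ∧ R p b c) :
    ∃ f : ∀ p, α p, f 0 = a ∧ (∀ p, P p (f p)) ∧ ∀ p, R p (f p) (f (p + 1)) := by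
  choose c hP hR using h
  let f : ∀ p, {b : α p // P p b} := fun p =>
    Nat.rec ⟨a, ha⟩ (fun p b => ⟨c p b.1 b.2, hP p b.1 b.2⟩) p
  exact ⟨fun p => (f p).1, rfl, fun p => (f p).2, fun p => hR p (f p).1 (f p).2⟩

theorem exists_lift_of_single {ι X Y : Type*} [AddCommGroup X] [Module B X] [AddCommGroup Y]
    [Module B Y] {f : X →ₗ[B] Y} {φ : (ι →₀ B) →ₗ[B] Y} {S : ι → Set X}
    (h : ∀ t, ∃ z ∈ S t, f z = φ (Finsupp.single t 1)) :
    ∃ ψ : (ι →₀ B) →ₗ[B] X, (∀ t, ψ (Finsupp.single t 1) ∈ S t) ∧ f ∘ₗ ψ = φ := by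
  choose z hzS hz using h
  refine ⟨Finsupp.linearCombination B z, fun t => by simpa using hzS t, ?_⟩
  ext t
  simp [hz]

theorem exists_lift_of_forall_mem_range {ι X Y : Type*} [AddCommGroup X] [Module B X]
    [AddCommGroup Y] [Module B Y] {f : X →ₗ[B] Y} {φ : (ι →₀ B) →ₗ[B] Y}
    (h : ∀ y, φ y ∈ Set.range f) : ∃ ψ : (ι →₀ B) →ₗ[B] X, f ∘ₗ ψ = φ := by
  obtain ⟨ψ, -, hψ⟩ := exists_lift_of_single (S := fun _ => Set.univ) fun t =>
    let ⟨z, hz⟩ := h (Finsupp.single t 1)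
    ⟨z, Set.mem_univ z, hz⟩
  exact ⟨ψ, hψ⟩

namespace FreeRes

variable {𝒜 : ℤ → Submodule k B} {I : Ideal B} (F G : FreeRes 𝒜 I)

theorem d_comp_d (p : ℕ) : F.d p ∘ₗ F.d (p + 1) = 0 := by
  cases p with
  | zero =>
    have := F.isEmpty_zero
    exact LinearMap.ext fun y => Subsingleton.elim _ _
  | succ p => exact (F.exact_d p).linearMap_comp_eq_zero

/-- `Tor_p^B(B / I, X)` vanishes in degree `e`. -/
def TorVanish {X : Type*} [AddCommGroup X] [Module B X] (gr : ℤ → AddSubgroup X) (p : ℕ) (e : ℤ) :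
    Prop :=
  ∀ y ∈ finGrading (F.deg (p + 1)) gr e, coefMap X (F.d p) y = 0 →
    ∃ z ∈ finGrading (F.deg (p + 2)) gr e, coefMap X (F.d (p + 1)) z = y

theorem torVanish_of_forall_mem_range {X : Type*} [AddCommGroup X] [Module B X]
    {gr : ℤ → AddSubgroup X} [SetLike.GradedSMul 𝒜 gr] (hgr : IsInternal gr) {p : ℕ}
    {e : ℤ} (h : ∀ y ∈ finGrading (F.deg (p + 1)) gr e, coefMap X (F.d p) y = 0 →
      y ∈ LinearMap.range (coefMap X (F.d (p + 1)))) : F.TorVanish gr p e := by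
  intro y hy hy0
  obtain ⟨z, rfl⟩ := h y hy hy0
  exact (F.isGradedMap_d (p + 1)).exists_homogeneous_coefMap_eq gr hgr hy

theorem exists_nullHomotopy (φ : ∀ p, (G.ι p →₀ B) →ₗ[B] (F.ι p →₀ B))
    (hφ : ∀ p, F.d p ∘ₗ φ (p + 1) = φ p ∘ₗ G.d p) (hφ1 : F.aug ∘ₗ φ 1 = 0) :
    ∃ h : ∀ p, (G.ι p →₀ B) →ₗ[B] (F.ι (p + 1) →₀ B),
      ∀ p, F.d (p + 1) ∘ₗ h (p + 1) = φ (p + 1) - h p ∘ₗ G.d p := by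
  obtain ⟨h, -, -, hR⟩ := exists_seq (α := fun p => (G.ι p →₀ B) →ₗ[B] (F.ι (p + 1) →₀ B))
    (P := fun p h => ∀ y, (φ (p + 1) - h ∘ₗ G.d p) y ∈ Set.range (F.d (p + 1)))
    (R := fun p h h' => F.d (p + 1) ∘ₗ h' = φ (p + 1) - h ∘ₗ G.d p) 0
    (fun y => (F.exact_aug _).1 (by simpa using LinearMap.congr_fun hφ1 y))
    (fun p h hP => by
      obtain ⟨h', hh'⟩ := exists_lift_of_forall_mem_range hP
      refine ⟨h', fun y => (F.exact_d p _).1 ?_, hh'⟩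
      rw [LinearMap.sub_apply, map_sub, ← LinearMap.comp_apply, hφ, ← LinearMap.comp_apply,
        ← LinearMap.comp_assoc, hh', LinearMap.sub_comp, LinearMap.comp_assoc _ _ h, G.d_comp_d,
        LinearMap.comp_zero, LinearMap.sub_apply, LinearMap.zero_apply, sub_zero, sub_self])
  exact ⟨h, hR⟩

theorem coefMap_mem_range_of_aug_comp_eq_zero (φ : ∀ p, (G.ι p →₀ B) →ₗ[B] (F.ι p →₀ B))
    (hφ : ∀ p, F.d p ∘ₗ φ (p + 1) = φ p ∘ₗ G.d p) (hφ1 : F.aug ∘ₗ φ 1 = 0)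
    {X : Type*} [AddCommGroup X] [Module B X] {p : ℕ} {y : G.ι (p + 1) →₀ X}
    (hy : coefMap X (G.d p) y = 0) :
    coefMap X (φ (p + 1)) y ∈ LinearMap.range (coefMap X (F.d (p + 1))) := by
  obtain ⟨h, hh⟩ := exists_nullHomotopy F G φ hφ hφ1
  refine ⟨coefMap X (h (p + 1)) y, ?_⟩
  rw [coefMap_coefMap, hh, coefMap_sub, ← coefMap_coefMap, hy, map_zero, sub_zero]

theorem exists_graded_lift_d [GradedAlgebra 𝒜] {ι : Type u} {deg : ι → ℤ} {p : ℕ}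
    {φ : (ι →₀ B) →ₗ[B] (F.ι p →₀ B)} (hφ : IsGradedMap 𝒜 deg (F.deg p) φ)
    (h : ∀ y, φ y ∈ Set.range (F.d p)) :
    ∃ ψ, IsGradedMap 𝒜 deg (F.deg (p + 1)) ψ ∧ F.d p ∘ₗ ψ = φ := by
  have hex (t : ι) : ∃ z ∈ freeGrading 𝒜 (F.deg (p + 1)) (deg t),
      F.d p z = φ (Finsupp.single t 1) := by
    obtain ⟨z, hz⟩ := h (Finsupp.single t 1)
    rw [← hz]
    exact (F.isGradedMap_d p).exists_homogeneous_eq (hz ▸ hφ t)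
  exact exists_lift_of_single (f := F.d p)
    (S := fun t => (freeGrading 𝒜 (F.deg (p + 1)) (deg t) : Set _)) hex

theorem exists_chainMap_succ [GradedAlgebra 𝒜] :
    ∃ f : ∀ p, (G.ι (p + 1) →₀ B) →ₗ[B] (F.ι (p + 1) →₀ B),
      (∀ p, IsGradedMap 𝒜 (G.deg (p + 1)) (F.deg (p + 1)) (f p)) ∧
      (∀ p, F.d (p + 1) ∘ₗ f (p + 1) = f p ∘ₗ G.d (p + 1)) ∧ F.aug ∘ₗ f 0 = G.aug := by
  obtain ⟨f₀, hf₀, haug⟩ := exists_lift_of_single fun t => F.aug_lift _ _ (G.aug_mem t)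
  obtain ⟨f, hf0, hP, hR⟩ := exists_seq
    (α := fun p => (G.ι (p + 1) →₀ B) →ₗ[B] (F.ι (p + 1) →₀ B))
    (P := fun p f => IsGradedMap 𝒜 (G.deg (p + 1)) (F.deg (p + 1)) f ∧
      ∀ y, (f ∘ₗ G.d (p + 1)) y ∈ Set.range (F.d (p + 1)))
    (R := fun p f f' => F.d (p + 1) ∘ₗ f' = f ∘ₗ G.d (p + 1)) f₀
    ⟨hf₀, fun y => (F.exact_aug _).1 (by
      rw [← LinearMap.comp_apply, ← LinearMap.comp_assoc, haug,
        G.exact_aug.linearMap_comp_eq_zero, LinearMap.zero_apply])⟩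
    (fun p f hf => by
      obtain ⟨f', hf', hc⟩ := F.exists_graded_lift_d (p := p + 1)
        (φ := f ∘ₗ G.d (p + 1)) (fun t => hf.1.map_mem (G.isGradedMap_d (p + 1) t)) hf.2
      refine ⟨f', ⟨hf', fun y => (F.exact_d p _).1 ?_⟩, hc⟩
      rw [← LinearMap.comp_apply, ← LinearMap.comp_assoc, hc, LinearMap.comp_assoc, G.d_comp_d,
        LinearMap.comp_zero, LinearMap.zero_apply])
  exact ⟨f, fun p => (hP p).1, hR, hf0 ▸ haug⟩

theorem exists_chainMap [GradedAlgebra 𝒜] :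
    ∃ f : ∀ p, (G.ι p →₀ B) →ₗ[B] (F.ι p →₀ B), (∀ p, IsGradedMap 𝒜 (G.deg p) (F.deg p) (f p)) ∧
      (∀ p, F.d p ∘ₗ f (p + 1) = f p ∘ₗ G.d p) ∧ F.aug ∘ₗ f 1 = G.aug := by
  obtain ⟨f, hf, hfd, haug⟩ := exists_chainMap_succ F G
  have := F.isEmpty_zero
  have := G.isEmpty_zero
  refine ⟨fun p => Nat.casesOn p 0 f, fun p => ?_, fun p => ?_, haug⟩
  · cases p with
    | zero => exact isEmptyElim
    | succ p => exact hf p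
  · cases p with
    | zero => exact LinearMap.ext fun y => Subsingleton.elim _ _
    | succ p => exact hfd p

variable {F} in
theorem TorVanish.of_freeRes [GradedAlgebra 𝒜] {X : Type*} [AddCommGroup X] [Module B X]
    {gr : ℤ → AddSubgroup X} [SetLike.GradedSMul 𝒜 gr] (hgr : IsInternal gr) {p : ℕ}
    {e : ℤ} (hF : F.TorVanish gr p e) : G.TorVanish gr p e := by
  refine G.torVanish_of_forall_mem_range hgr fun y hy hy0 => ?_
  obtain ⟨f, hf, hfc, hfa⟩ := exists_chainMap F G
  obtain ⟨g, -, hgc, hga⟩ := exists_chainMap G F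
  obtain ⟨z, -, hz⟩ := hF (coefMap X (f (p + 1)) y) ((hf (p + 1)).coefMap_mem gr hy) (by
    rw [coefMap_coefMap, hfc, ← coefMap_coefMap, hy0, map_zero])
  have hgf := coefMap_mem_range_of_aug_comp_eq_zero G G (fun p => g p ∘ₗ f p - LinearMap.id)
    (fun p => by
      rw [LinearMap.comp_sub, LinearMap.sub_comp, LinearMap.comp_id, LinearMap.id_comp,
        ← LinearMap.comp_assoc, hgc, LinearMap.comp_assoc, hfc, LinearMap.comp_assoc])
    (by rw [LinearMap.comp_sub, ← LinearMap.comp_assoc, hga, hfa, LinearMap.comp_id, sub_self]) hy0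
  have hmem : coefMap X (g (p + 1)) (coefMap X (f (p + 1)) y) ∈
      LinearMap.range (coefMap X (G.d (p + 1))) :=
    ⟨coefMap X (g (p + 2)) z, by rw [coefMap_coefMap, hgc, ← coefMap_coefMap, hz]⟩
  have hy' := sub_mem hmem hgf
  rwa [coefMap_sub, coefMap_id, LinearMap.id_apply, coefMap_coefMap,
    sub_sub_cancel] at hy'

theorem mem_range_coefMap_of_isUnit {c : B} (hc : c ∈ I) {X : Type*} [AddCommGroup X] [Module B X]
    (hX : IsUnit (algebraMap B (Module.End B X) c)) {p : ℕ} {y : F.ι (p + 1) →₀ X}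
    (hy : coefMap X (F.d p) y = 0) : y ∈ LinearMap.range (coefMap X (F.d (p + 1))) := by
  obtain ⟨g, -, hg⟩ := isUnit_iff_exists.1 hX
  obtain ⟨z, hz⟩ := coefMap_mem_range_of_aug_comp_eq_zero F F (fun p => c • LinearMap.id)
    (fun p => by
      rw [LinearMap.comp_smul, LinearMap.smul_comp, LinearMap.comp_id, LinearMap.id_comp])
    (by
      rw [LinearMap.comp_smul, LinearMap.comp_id]
      refine LinearMap.ext fun y => ?_
      obtain ⟨b, hb⟩ := Ideal.Quotient.mk_surjective (F.aug y)
      rw [LinearMap.smul_apply, ← hb, Algebra.smul_def, Ideal.Quotient.algebraMap_eq,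
        Ideal.Quotient.eq_zero_iff_mem.2 hc, zero_mul, LinearMap.zero_apply]) hy
  rw [map_smul, coefMap_id, LinearMap.smul_apply, LinearMap.id_apply] at hz
  refine ⟨Finsupp.mapRange.linearMap g z, ?_⟩
  rw [← mapRange_coefMap, hz]
  ext s
  simpa using LinearMap.congr_fun hg (y s)

end FreeRes

end FreeRes

/-! ### Tor of torsion modules -/

section Splitting

variable {k : Type*} [Field k] {U V W : Type*} [AddCommGroup U] [Module k U] [AddCommGroup V]
  [Module k V] [AddCommGroup W] [Module k W]

theorem exists_quasiInverse (f : V →ₗ[k] W) : ∃ g : W →ₗ[k] V, ∀ v, f (g (f v)) = f v := by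
  obtain ⟨s, hs⟩ := f.rangeRestrict.exists_rightInverse_of_surjective f.range_rangeRestrict
  obtain ⟨g, hg⟩ := LinearMap.exists_extend s
  refine ⟨g, fun v => ?_⟩
  have hgs : g (f v) = s (f.rangeRestrict v) := LinearMap.congr_fun hg (f.rangeRestrict v)
  rw [hgs]
  exact congrArg Subtype.val (LinearMap.congr_fun hs (f.rangeRestrict v))

theorem exists_splitting (f : U →ₗ[k] V) (g : V →ₗ[k] W) (U₀ : Submodule k U) (V₀ : Submodule k V)
    (h : ∀ v ∈ V₀, g v = 0 → ∃ u ∈ U₀, f u = v) :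
    ∃ (s : V →ₗ[k] U) (t : W →ₗ[k] V), (∀ v, s v ∈ U₀) ∧ (∀ w, t w ∈ V₀) ∧
      ∀ v ∈ V₀, f (s v) + t (g v) = v := by
  obtain ⟨g', hg'⟩ := exists_quasiInverse (g.domRestrict V₀)
  obtain ⟨f', hf'⟩ := exists_quasiInverse (f.domRestrict U₀)
  simp only [LinearMap.domRestrict_apply, Subtype.forall] at hg' hf'
  refine ⟨U₀.subtype ∘ₗ f' ∘ₗ (LinearMap.id - V₀.subtype ∘ₗ g' ∘ₗ g), V₀.subtype ∘ₗ g',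
    fun v => (f' _).2, fun w => (g' w).2, fun v hv => ?_⟩
  obtain ⟨u, hu, hfu⟩ := h (v - g' (g v)) (sub_mem hv (g' (g v)).2) (by
    rw [map_sub, hg' v hv, sub_self])
  simp only [LinearMap.comp_apply, LinearMap.sub_apply, LinearMap.id_apply, Submodule.subtype_apply]
  rw [← hfu, hf' u hu, hfu, sub_add_cancel]

end Splitting

section Residue

variable {k : Type w} [Field k] {B : Type u} [CommRing B] [Algebra k B]
  (𝒜 : ℤ → Submodule k B)

/-- The grading of the residue field `B / B₊`, which is concentrated in degree `0`. -/
def residueGrading (d : ℤ) : AddSubgroup (B ⧸ irrelevantIdeal 𝒜) := if d = 0 then ⊤ else ⊥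

variable {𝒜}

theorem mem_residueGrading {d : ℤ} {c : B ⧸ irrelevantIdeal 𝒜} :
    c ∈ residueGrading 𝒜 d ↔ (d ≠ 0 → c = 0) := by
  unfold residueGrading
  split_ifs with h <;> simp [h]

theorem smul_residue_eq_zero {b : B} (hb : b ∈ irrelevantIdeal 𝒜)
    (c : B ⧸ irrelevantIdeal 𝒜) : b • c = 0 := by
  rw [Algebra.smul_def, Ideal.Quotient.algebraMap_eq, Ideal.Quotient.eq_zero_iff_mem.2 hb, zero_mul]

theorem mem_irrelevantIdeal {d : ℤ} (hd : 0 < d) {b : B} (hb : b ∈ 𝒜 d) :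
    b ∈ irrelevantIdeal 𝒜 := Ideal.subset_span ⟨d, hd, hb⟩

theorem gradedSMul_residueGrading (h𝒜 : ∀ d < 0, 𝒜 d = ⊥) :
    SetLike.GradedSMul 𝒜 (residueGrading 𝒜) where
  smul_mem := fun a d b c hb hc => by
    rw [mem_residueGrading] at hc ⊢
    intro h
    by_cases hd : d = 0
    · rw [hd, vadd_eq_add, add_zero] at h
      rcases lt_or_gt_of_ne h with h' | h'
      · rw [h𝒜 a h'] at hb
        rw [(Submodule.mem_bot _).1 hb, zero_smul]
      · exact smul_residue_eq_zero (mem_irrelevantIdeal h' hb) c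
    · rw [hc hd, smul_zero]

variable (𝒜) in
theorem isInternal_residueGrading : IsInternal (residueGrading 𝒜) := by
  refine isInternal_of_iSup_eq_top_of_sum_eq_zero (eq_top_iff.2 fun _ _ =>
    AddSubgroup.mem_iSup_of_mem 0 (mem_residueGrading.2 fun h => absurd rfl h))
    fun T c hc h0 d hd => ?_
  by_cases h : d = 0
  · rwa [Finset.sum_eq_single_of_mem d hd fun e he hed =>
      mem_residueGrading.1 (hc e he) (h ▸ hed)] at h0
  · exact mem_residueGrading.1 (hc d hd) h

variable (𝒜) in
theorem algebraMap_residue_surjective [GradedAlgebra 𝒜] (h𝒜 : ∀ d < 0, 𝒜 d = ⊥)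
    (h0 : 𝒜 0 = 1) : Function.Surjective (algebraMap k (B ⧸ irrelevantIdeal 𝒜)) := by
  intro c
  obtain ⟨b, rfl⟩ := Ideal.Quotient.mk_surjective c
  refine map_mem_of_isInternal (isInternal_toAddSubgroup 𝒜)
    (Ideal.Quotient.mk (irrelevantIdeal 𝒜)).toAddMonoidHom
    (K := (algebraMap k (B ⧸ irrelevantIdeal 𝒜)).range.toAddSubgroup) (fun d b hb => ?_) b
  have hb' : b ∈ 𝒜 d := hb
  rcases lt_trichotomy d 0 with h | rfl | h
  · rw [h𝒜 d h] at hb'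
    exact ⟨0, by simp [(Submodule.mem_bot _).1 hb']⟩
  · rw [h0] at hb'
    obtain ⟨z, rfl⟩ := Submodule.mem_one.1 hb'
    exact ⟨z, rfl⟩
  · exact ⟨0, (map_zero _).trans
      (Ideal.Quotient.eq_zero_iff_mem.2 (mem_irrelevantIdeal h hb')).symm⟩

/-- The part of degree `e` of `F ⊗ (B / B₊)` as a vector space, `F` being the graded free module
with basis elements in the degrees `deg`. -/
def residueSubmodule {ι : Type u} (deg : ι → ℤ) (e : ℤ) :
    Submodule k (ι →₀ B ⧸ irrelevantIdeal 𝒜) where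
  carrier := finGrading deg (residueGrading 𝒜) e
  zero_mem' := zero_mem _
  add_mem' := add_mem
  smul_mem' := fun z y hy s => mem_residueGrading.2 fun h => by
    rw [Finsupp.smul_apply, mem_residueGrading.1 (hy s) h, smul_zero]

theorem eq_zero_of_mem_residueSubmodule {ι : Type u} {deg : ι → ℤ} {e : ℤ}
    {y : ι →₀ B ⧸ irrelevantIdeal 𝒜} (hy : y ∈ residueSubmodule deg e) {s : ι} (hs : deg s ≠ e) :
    y s = 0 :=
  mem_residueGrading.1 (hy s) (sub_ne_zero.2 hs.symm)

theorem exists_graded_lift [GradedAlgebra 𝒜] (h𝒜 : ∀ d < 0, 𝒜 d = ⊥) (h0 : 𝒜 0 = 1)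
    {ι κ : Type u} (deg : ι → ℤ) (deg' : κ → ℤ)
    (h : ℤ → (ι →₀ B ⧸ irrelevantIdeal 𝒜) →ₗ[k] (κ →₀ B ⧸ irrelevantIdeal 𝒜))
    (hh : ∀ e v, h e v ∈ residueSubmodule deg' e) :
    ∃ H : (ι →₀ B) →ₗ[B] (κ →₀ B), IsGradedMap 𝒜 deg deg' H ∧
      ∀ e, ∀ v ∈ residueSubmodule deg e, coefMap (B ⧸ irrelevantIdeal 𝒜) H v = h e v := by
  obtain ⟨r, hr⟩ := (Algebra.linearMap k (B ⧸ irrelevantIdeal 𝒜)).exists_rightInverse_of_surjective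
    (LinearMap.range_eq_top.2 (algebraMap_residue_surjective 𝒜 h𝒜 h0))
  have hr' (c : B ⧸ irrelevantIdeal 𝒜) : algebraMap k _ (r c) = c := LinearMap.congr_fun hr c
  let H : (ι →₀ B) →ₗ[B] (κ →₀ B) := Finsupp.linearCombination B fun s =>
    Finsupp.mapRange.linearMap (Algebra.linearMap k B ∘ₗ r) (h (deg s) (Finsupp.single s 1))
  have hH (s : ι) (t : κ) : H (Finsupp.single s 1) t =
      algebraMap k B (r (h (deg s) (Finsupp.single s 1) t)) := by
    simp [H]
  refine ⟨H, fun s t => ?_, fun e v hv => ?_⟩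
  · rw [hH]
    by_cases hst : deg' t = deg s
    · rw [hst, sub_self, h0]
      exact Submodule.mem_one.2 ⟨_, rfl⟩
    · rw [eq_zero_of_mem_residueSubmodule (hh _ _) hst, map_zero, map_zero]
      exact zero_mem _
  · rw [← Finsupp.sum_single v, Finsupp.sum, map_sum, map_sum]
    refine Finset.sum_congr rfl fun s hs => ?_
    have hse : deg s = e :=
      not_not.1 fun hne => Finsupp.mem_support_iff.1 hs (eq_zero_of_mem_residueSubmodule hv hne)
    have hsingle : Finsupp.single s (v s) =
        r (v s) • Finsupp.single s (1 : B ⧸ irrelevantIdeal 𝒜) := by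
      rw [Finsupp.smul_single, Algebra.smul_def, mul_one, hr']
    ext t
    rw [coefMap_single, hH, algebraMap_smul, hsingle, map_smul, Finsupp.smul_apply, hse,
      Algebra.smul_def, Algebra.smul_def, hr', hr', mul_comm]

end Residue

namespace FreeRes

variable {k : Type w} [Field k] {B : Type u} [CommRing B] [Algebra k B]
  {𝒜 : ℤ → Submodule k B} {I : Ideal B} (G : FreeRes 𝒜 I)

theorem exists_residue_splitting (h𝒜 : ∀ d < 0, 𝒜 d = ⊥) (p : ℕ) (e : ℤ) :
    ∃ (h : (G.ι (p + 1) →₀ B ⧸ irrelevantIdeal 𝒜) →ₗ[k] (G.ι (p + 2) →₀ B ⧸ irrelevantIdeal 𝒜))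
      (h' : (G.ι p →₀ B ⧸ irrelevantIdeal 𝒜) →ₗ[k] (G.ι (p + 1) →₀ B ⧸ irrelevantIdeal 𝒜)),
      (∀ v, h v ∈ residueSubmodule (𝒜 := 𝒜) (G.deg (p + 2)) e) ∧
      (∀ v, h' v ∈ residueSubmodule (𝒜 := 𝒜) (G.deg (p + 1)) e) ∧
      (G.TorVanish (residueGrading 𝒜) p e →
        ∀ v ∈ residueSubmodule (𝒜 := 𝒜) (G.deg (p + 1)) e,
          coefMap _ (G.d (p + 1)) (h v) + h' (coefMap _ (G.d p) v) = v) := by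
  have := gradedSMul_residueGrading h𝒜
  by_cases he : G.TorVanish (residueGrading 𝒜) p e
  · obtain ⟨h, h', hmem, hmem', hsplit⟩ := exists_splitting
      ((coefMap (B ⧸ irrelevantIdeal 𝒜) (G.d (p + 1))).restrictScalars k)
      ((coefMap (B ⧸ irrelevantIdeal 𝒜) (G.d p)).restrictScalars k)
      (residueSubmodule (𝒜 := 𝒜) (G.deg (p + 2)) e) (residueSubmodule (G.deg (p + 1)) e)
      (fun v hv hv0 => he v hv hv0)
    exact ⟨h, h', hmem, hmem', fun _ => hsplit⟩
  · exact ⟨0, 0, fun _ => zero_mem _, fun _ => zero_mem _, fun h => absurd h he⟩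

theorem exists_contraction [GradedAlgebra 𝒜] (h𝒜 : ∀ d < 0, 𝒜 d = ⊥) (h0 : 𝒜 0 = 1) (p : ℕ) :
    ∃ (H : (G.ι (p + 1) →₀ B) →ₗ[B] (G.ι (p + 2) →₀ B))
      (H' : (G.ι p →₀ B) →ₗ[B] (G.ι (p + 1) →₀ B)),
      IsGradedMap 𝒜 (G.deg (p + 1)) (G.deg (p + 2)) H ∧
      ∀ s, G.TorVanish (residueGrading 𝒜) p (G.deg (p + 1) s) → ∀ t,
        (LinearMap.id - G.d (p + 1) ∘ₗ H - H' ∘ₗ G.d p :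
          (G.ι (p + 1) →₀ B) →ₗ[B] (G.ι (p + 1) →₀ B)) (Finsupp.single s 1) t ∈
            irrelevantIdeal 𝒜 := by
  have := gradedSMul_residueGrading h𝒜
  choose h h' hmem hmem' hsplit using G.exists_residue_splitting h𝒜 p
  obtain ⟨H, hH, hHh⟩ := exists_graded_lift h𝒜 h0 (G.deg (p + 1)) (G.deg (p + 2)) h hmem
  obtain ⟨H', -, hHh'⟩ := exists_graded_lift h𝒜 h0 (G.deg p) (G.deg (p + 1)) h' hmem'
  refine ⟨H, H', hH, fun s hs t => ?_⟩
  have hsingle : Finsupp.single s (1 : B ⧸ irrelevantIdeal 𝒜) ∈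
      finGrading (G.deg (p + 1)) (residueGrading 𝒜) (G.deg (p + 1) s) :=
    single_mem_finGrading (mem_residueGrading.2 fun h => absurd (sub_self _) h)
  have hid := hsplit _ hs _ hsingle
  rw [← hHh _ _ hsingle, ← hHh' _ _ ((G.isGradedMap_d p).coefMap_mem _ hsingle),
    coefMap_coefMap, coefMap_coefMap] at hid
  have hcoef := coefMap_single (X := B ⧸ irrelevantIdeal 𝒜)
    (LinearMap.id - G.d (p + 1) ∘ₗ H - H' ∘ₗ G.d p) s 1 t
  rw [coefMap_sub, coefMap_sub, coefMap_id, LinearMap.id_apply, sub_sub, hid, sub_self,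
    Algebra.smul_def, mul_one] at hcoef
  exact Ideal.Quotient.eq_zero_iff_mem.1 hcoef.symm

section Torsion

variable [GradedAlgebra 𝒜] {N : Type*} [AddCommGroup N] [Module B N] {𝒩 : ℤ → AddSubgroup N}
  [SetLike.GradedSMul 𝒜 𝒩]

theorem exists_coefMap_eq_of_pow_smul_eq_zero (h𝒜 : ∀ d < 0, 𝒜 d = ⊥) (h0 : 𝒜 0 = 1) {p : ℕ}
    {e : ℤ} (hN : ∀ d, 𝒩 d ≠ ⊥ → G.TorVanish (residueGrading 𝒜) p (e - d)) (K : ℕ)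
    {y : G.ι (p + 1) →₀ N} (hy : y ∈ finGrading (G.deg (p + 1)) 𝒩 e)
    (hy0 : coefMap N (G.d p) y = 0) (hK : ∀ s, ∀ b ∈ irrelevantIdeal 𝒜 ^ K, b • y s = 0) :
    ∃ z ∈ finGrading (G.deg (p + 2)) 𝒩 e, coefMap N (G.d (p + 1)) z = y := by
  obtain ⟨H, H', hH, hΘ⟩ := G.exists_contraction h𝒜 h0 p
  set Θ : (G.ι (p + 1) →₀ B) →ₗ[B] (G.ι (p + 1) →₀ B) :=
    LinearMap.id - G.d (p + 1) ∘ₗ H - H' ∘ₗ G.d p with hΘdef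
  induction K generalizing y with
  | zero =>
    have hy : y = 0 := Finsupp.ext fun s => by simpa using hK s 1 (by simp)
    exact ⟨0, zero_mem _, by rw [map_zero, hy]⟩
  | succ K ih =>
    have hΘy : coefMap N Θ y = y - coefMap N (G.d (p + 1)) (coefMap N H y) := by
      rw [hΘdef, coefMap_sub, coefMap_sub, coefMap_id, coefMap_coefMap, ← coefMap_coefMap _ H',
        hy0, map_zero, sub_zero, LinearMap.id_apply]
    have hdeg (t : G.ι (p + 1)) (ht : t ∈ y.support) :
        G.TorVanish (residueGrading 𝒜) p (G.deg (p + 1) t) := by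
      have hvan := hN (e - G.deg (p + 1) t) fun hbot =>
        Finsupp.mem_support_iff.1 ht (AddSubgroup.mem_bot.1 (hbot ▸ hy t))
      rwa [sub_sub_cancel] at hvan
    have hHy := hH.coefMap_mem 𝒩 hy
    obtain ⟨z, hz, hzy⟩ := ih (hΘy ▸ sub_mem hy ((G.isGradedMap_d (p + 1)).coefMap_mem 𝒩 hHy))
      (by rw [hΘy, map_sub, hy0, coefMap_coefMap, G.d_comp_d, map_zero, LinearMap.zero_apply,
        sub_zero])
      (fun s b hb => by
        rw [coefMap_apply, Finset.smul_sum]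
        refine Finset.sum_eq_zero fun t ht => ?_
        rw [smul_smul]
        exact hK t _ (pow_succ (irrelevantIdeal 𝒜) K ▸
          Ideal.mul_mem_mul hb (hΘ t (hdeg t ht) s)))
    exact ⟨z + coefMap N H y, add_mem hz hHy, by rw [map_add, hzy, hΘy, sub_add_cancel]⟩

theorem torVanish_of_torsion (h𝒜 : ∀ d < 0, 𝒜 d = ⊥) (h0 : 𝒜 0 = 1)
    (htor : ∀ y : N, ∃ K : ℕ, ∀ b ∈ irrelevantIdeal 𝒜 ^ K, b • y = 0) {p : ℕ} {e : ℤ}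
    (hN : ∀ d, 𝒩 d ≠ ⊥ → G.TorVanish (residueGrading 𝒜) p (e - d)) : G.TorVanish 𝒩 p e := by
  intro y hy hy0
  choose K hK using htor
  refine G.exists_coefMap_eq_of_pow_smul_eq_zero h𝒜 h0 hN (y.support.sup fun s => K (y s)) hy hy0
    fun s b hb => ?_
  by_cases hs : s ∈ y.support
  · exact hK (y s) b (Ideal.pow_le_pow_right (Finset.le_sup (f := fun s => K (y s)) hs) hb)
  · rw [Finsupp.notMem_support_iff.1 hs, smul_zero]

end Torsion

end FreeRes

/-! ### The canonical resolutions -/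

theorem subquotGrading_eq_bot_iff {B : Type*} [CommRing B] {X : Type*} [AddCommGroup X]
    [Module B X] {gr : ℤ → AddSubgroup X} {Z D : Submodule B X} {e : ℤ} :
    subquotGrading gr Z D e = ⊥ ↔ ∀ y ∈ Z, y ∈ gr e → y ∈ D := by
  constructor
  · intro h y hy hye
    have hmk : (D.submoduleOf Z).mkQ ⟨y, hy⟩ ∈ subquotGrading gr Z D e := ⟨⟨y, hy⟩, hye, rfl⟩
    rwa [h, AddSubgroup.mem_bot, Submodule.mkQ_apply, Submodule.Quotient.mk_eq_zero] at hmk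
  · intro h
    rw [eq_bot_iff]
    rintro _ ⟨y, hy, rfl⟩
    exact (Submodule.Quotient.mk_eq_zero _).2 (h y.1 y.2 hy)

theorem le_of_isInternal_comap {B : Type*} [Ring B] {X : Type*} [AddCommGroup X] [Module B X]
    {gr : ℤ → AddSubgroup X} {R P : Submodule B X}
    (hR : IsInternal fun d => (gr d).comap R.subtype.toAddMonoidHom)
    (h : ∀ d, ∀ y ∈ R, y ∈ gr d → y ∈ P) : R ≤ P := fun y hy =>
  map_mem_of_isInternal hR R.subtype.toAddMonoidHom (K := P.toAddSubgroup)
    (fun d z hz => h d z z.2 hz) ⟨y, hy⟩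

theorem linearCombination_single_mem {B : Type*} [Semiring B] {κ X : Type*} [AddCommGroup X]
    [Module B X] {v : κ → X} {P : AddSubgroup X} {t : κ} (h : v t ∈ P) :
    Finsupp.linearCombination B v (Finsupp.single t 1) ∈ P := by
  rwa [Finsupp.linearCombination_single, one_smul]

section Stage

variable {k : Type w} [Field k] {B : Type u} [CommRing B] [Algebra k B]
  (𝒜 : ℤ → Submodule k B)

theorem single_one_mem_freeGrading [GradedAlgebra 𝒜] {ι : Type u} (deg : ι → ℤ) (t : ι) :
    Finsupp.single t 1 ∈ freeGrading 𝒜 deg (deg t) :=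
  single_mem_finGrading (gr := fun d => (𝒜 d).toAddSubgroup)
    ((sub_self (deg t)).symm ▸ (SetLike.GradedOne.one_mem : (1 : B) ∈ 𝒜 0))

theorem isGradedMap_diff (s : Stage B) :
    IsGradedMap 𝒜 (s.next 𝒜).deg s.deg (s.diff 𝒜) := fun t =>
  linearCombination_single_mem (v := fun t : s.NextIndex 𝒜 => (t.2 : s.ι →₀ B)) t.2.2.1

variable [GradedAlgebra 𝒜] {M : Type u} [AddCommGroup M] [Module B M] {ℳ : ℤ → AddSubgroup M}
  [SetLike.GradedSMul 𝒜 ℳ]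

theorem isInternal_resStage_rel (hM : IsInternal ℳ) :
    ∀ p, IsInternal fun d : ℤ => AddSubgroup.comap (G := (resStage 𝒜 ℳ p).rel)
      (resStage 𝒜 ℳ p).rel.subtype.toAddMonoidHom (freeGrading 𝒜 (resStage 𝒜 ℳ p).deg d)
  | 0 => isInternal_comap_ker (isInternal_freeGrading (𝒜 := 𝒜) (Stage.first (B := B) ℳ).deg) hM
      (Finsupp.linearCombination B fun s : Σ d : ℤ, ℳ d => (s.2 : M)).toAddMonoidHom
      fun _ _ hz => map_mem_of_single_mem (deg := (Stage.first (B := B) ℳ).deg) ℳ (fun t =>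
        linearCombination_single_mem (v := fun s : Σ d : ℤ, ℳ d => (s.2 : M)) t.2.2) hz
  | p + 1 => isInternal_comap_ker
      (isInternal_freeGrading (𝒜 := 𝒜) ((resStage 𝒜 ℳ p).next 𝒜).deg)
      (isInternal_freeGrading (𝒜 := 𝒜) (resStage 𝒜 ℳ p).deg)
      ((resStage 𝒜 ℳ p).diff 𝒜).toAddMonoidHom
      fun _ _ hz => (isGradedMap_diff 𝒜 _).map_mem hz

theorem range_resDiff (hM : IsInternal ℳ) (p : ℕ) :
    LinearMap.range (resDiff 𝒜 ℳ p) = (resStage 𝒜 ℳ p).rel := by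
  refine (Finsupp.range_linearCombination _).trans (le_antisymm (Submodule.span_le.2 ?_)
    (le_of_isInternal_comap (isInternal_resStage_rel 𝒜 hM p) fun d y hy hyd => ?_))
  · rintro _ ⟨t, rfl⟩
    exact t.2.2.2
  · exact Submodule.subset_span ⟨⟨d, y, hyd, hy⟩, rfl⟩

theorem exact_resDiff (hM : IsInternal ℳ) (p : ℕ) :
    Function.Exact (resDiff 𝒜 ℳ (p + 1)) (resDiff 𝒜 ℳ p) :=
  LinearMap.exact_iff.2 (range_resDiff 𝒜 hM (p + 1)).symm

theorem exact_resDiff_linearCombination (hM : IsInternal ℳ) :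
    Function.Exact (resDiff 𝒜 ℳ 0)
      (Finsupp.linearCombination B fun s : Σ d : ℤ, ℳ d => (s.2 : M)) :=
  LinearMap.exact_iff.2 (range_resDiff 𝒜 hM 0).symm

end Stage

section ResidueTor

variable {k : Type w} [Field k] {B : Type u} [CommRing B] [Algebra k B]
  {𝒜 : ℤ → Submodule k B} {M : Type u} [AddCommGroup M] [Module B M] {ℳ : ℤ → AddSubgroup M}

theorem residueGrading_le_quotientGrading [GradedAlgebra 𝒜] (h𝒜 : ∀ d < 0, 𝒜 d = ⊥)
    (h0 : 𝒜 0 = 1) (d : ℤ) :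
    residueGrading 𝒜 d ≤ quotientGrading 𝒜 (irrelevantIdeal 𝒜) d := by
  intro c hc
  by_cases hd : d = 0
  · obtain ⟨z, rfl⟩ := algebraMap_residue_surjective 𝒜 h𝒜 h0 c
    exact ⟨algebraMap k B z, hd ▸ h0 ▸ Submodule.algebraMap_mem z, rfl⟩
  · exact mem_residueGrading.1 hc hd ▸ zero_mem _

open Classical in
theorem finsuppScalarLeft_symm_mem_resTensorGrading [GradedAlgebra 𝒜] (h𝒜 : ∀ d < 0, 𝒜 d = ⊥)
    (h0 : 𝒜 0 = 1) {p : ℕ} {e : ℤ} {y : (resStage 𝒜 ℳ p).ι →₀ B ⧸ irrelevantIdeal 𝒜}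
    (hy : y ∈ finGrading (resStage 𝒜 ℳ p).deg (residueGrading 𝒜) e) :
    (TensorProduct.finsuppScalarLeft B (B ⧸ irrelevantIdeal 𝒜) (resStage 𝒜 ℳ p).ι).symm y ∈
      resTensorGrading 𝒜 ℳ p e := by
  obtain ⟨z, hz, rfl⟩ := exists_mapRange_eq_of_mem_finGrading_map
    (gr := fun d => (𝒜 d).toAddSubgroup) (irrelevantIdeal 𝒜).mkQ
    fun s => residueGrading_le_quotientGrading h𝒜 h0 _ (hy s)
  refine ⟨z, hz, ?_⟩
  rw [LinearEquiv.eq_symm_apply]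
  ext s
  refine (TensorProduct.finsuppScalarLeft_apply_tmul_apply z 1 s).trans ?_
  rw [Algebra.smul_def, mul_one]
  rfl

open Classical in
theorem coefMap_finsuppScalarLeft {B : Type*} [CommRing B] {ι κ X : Type*} [AddCommGroup X]
    [Module B X] (φ : (ι →₀ B) →ₗ[B] (κ →₀ B)) (z : TensorProduct B (ι →₀ B) X) :
    coefMap X φ (TensorProduct.finsuppScalarLeft B X ι z) =
      TensorProduct.finsuppScalarLeft B X κ (φ.rTensor X z) := by
  simp [coefMap]

open Classical in
theorem mem_range_coefMap_resDiff [GradedAlgebra 𝒜] (h𝒜 : ∀ d < 0, 𝒜 d = ⊥) (h0 : 𝒜 0 = 1)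
    {p : ℕ} {e : ℤ} (h : torGrading 𝒜 ℳ p e = ⊥)
    {y : (resStage 𝒜 ℳ p).ι →₀ B ⧸ irrelevantIdeal 𝒜}
    (hy : y ∈ finGrading (resStage 𝒜 ℳ p).deg (residueGrading 𝒜) e)
    (hcyc : (TensorProduct.finsuppScalarLeft B _ _).symm y ∈ torCycles 𝒜 ℳ p) :
    y ∈ LinearMap.range (coefMap (B ⧸ irrelevantIdeal 𝒜) (resDiff 𝒜 ℳ p)) := by
  obtain ⟨z, hz⟩ := subquotGrading_eq_bot_iff.1 h _ hcyc
    (finsuppScalarLeft_symm_mem_resTensorGrading h𝒜 h0 hy)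
  rw [LinearEquiv.eq_symm_apply] at hz
  exact ⟨_, (coefMap_finsuppScalarLeft _ z).trans hz⟩

open Classical in
theorem finsuppScalarLeft_symm_mem_torCycles {p : ℕ}
    {y : (resStage 𝒜 ℳ (p + 1)).ι →₀ B ⧸ irrelevantIdeal 𝒜}
    (hy : coefMap (B ⧸ irrelevantIdeal 𝒜) (resDiff 𝒜 ℳ p) y = 0) :
    (TensorProduct.finsuppScalarLeft B _ _).symm y ∈ torCycles 𝒜 ℳ (p + 1) := by
  rwa [← LinearEquiv.apply_symm_apply (TensorProduct.finsuppScalarLeft B _ _) y,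
    coefMap_finsuppScalarLeft, LinearEquiv.map_eq_zero_iff] at hy

end ResidueTor

section CanonicalRes

variable {k : Type w} [Field k] {B : Type u} [CommRing B] [Algebra k B]
  (𝒜 : ℤ → Submodule k B) (I : Ideal B)

instance gradedSMul_quotientGrading [GradedAlgebra 𝒜] :
    SetLike.GradedSMul 𝒜 (quotientGrading 𝒜 I) where
  smul_mem := by
    rintro a d b _ hb ⟨c, hc, rfl⟩
    exact ⟨b * c, SetLike.GradedMul.mul_mem hb hc, rfl⟩

instance gradedSMul_idealGrading [GradedAlgebra 𝒜] : SetLike.GradedSMul 𝒜 (idealGrading 𝒜 I) where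
  smul_mem := fun _ _ _ _ hb hc => SetLike.GradedMul.mul_mem hb hc

/-- The canonical resolution of `B / I`. -/
noncomputable def quotientRes [GradedAlgebra 𝒜] (hI : I.IsHomogeneous 𝒜) : FreeRes 𝒜 I where
  ι
    | 0 => PEmpty
    | p + 1 => (resStage 𝒜 (quotientGrading 𝒜 I) p).ι
  deg
    | 0 => fun _ => 0
    | p + 1 => (resStage 𝒜 (quotientGrading 𝒜 I) p).deg
  d
    | 0 => 0
    | p + 1 => resDiff 𝒜 (quotientGrading 𝒜 I) p
  aug := Finsupp.linearCombination B fun s : Σ d : ℤ, quotientGrading 𝒜 I d => (s.2 : B ⧸ I)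
  isEmpty_zero := inferInstanceAs (IsEmpty PEmpty)
  isGradedMap_d
    | 0 => fun _ => zero_mem _
    | p + 1 => isGradedMap_diff 𝒜 (resStage 𝒜 (quotientGrading 𝒜 I) p)
  aug_mem t := linearCombination_single_mem
    (v := fun s : Σ d : ℤ, quotientGrading 𝒜 I d => (s.2 : B ⧸ I)) t.2.2
  aug_lift e b hb := by
    let t : Σ d : ℤ, quotientGrading 𝒜 I d := ⟨e, b, hb⟩
    exact ⟨Finsupp.single t 1, single_one_mem_freeGrading 𝒜
      (Sigma.fst : (Σ d : ℤ, quotientGrading 𝒜 I d) → ℤ) t,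
      (Finsupp.linearCombination_single B 1 t).trans (one_smul B b)⟩
  exact_aug := exact_resDiff_linearCombination 𝒜 (isInternal_quotientGrading hI)
  exact_d := exact_resDiff 𝒜 (isInternal_quotientGrading hI)

/-- The map to `B` from the free module on the homogeneous elements of an ideal `I`; the free
module `B` is written as `PUnit →₀ B`. -/
noncomputable def idealCover :
    ((Σ d : ℤ, idealGrading 𝒜 I d) →₀ B) →ₗ[B] (PUnit.{u + 1} →₀ B) :=
  (Finsupp.lsingle PUnit.unit ∘ₗ I.subtype) ∘ₗ
    Finsupp.linearCombination B fun s : Σ d : ℤ, idealGrading 𝒜 I d => (s.2 : I)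

variable {I} in
theorem idealCover_apply_mem (y : (Σ d : ℤ, idealGrading 𝒜 I d) →₀ B) (t : PUnit.{u + 1}) :
    idealCover 𝒜 I y t ∈ I := by
  simp [idealCover]

theorem isGradedMap_idealCover :
    IsGradedMap 𝒜 (Sigma.fst : (Σ d : ℤ, idealGrading 𝒜 I d) → ℤ) (fun _ => 0)
      (idealCover 𝒜 I) := fun t s => by
  rw [idealCover, LinearMap.comp_apply, Finsupp.linearCombination_single, one_smul, sub_zero]
  exact (Finsupp.single_eq_same (M := B)).symm ▸ t.2.2

variable [GradedAlgebra 𝒜] {I}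

theorem exact_resDiff_idealCover (hI : I.IsHomogeneous 𝒜) :
    Function.Exact (resDiff 𝒜 (idealGrading 𝒜 I) 0) (idealCover 𝒜 I) :=
  (exact_resDiff_linearCombination 𝒜 (isInternal_idealGrading hI)).comp_injective _
    ((Finsupp.single_injective _).comp I.subtype_injective) (Finsupp.single_zero _)

theorem linearCombination_idealGrading_surjective (hI : I.IsHomogeneous 𝒜) :
    Function.Surjective (Finsupp.linearCombination B
      fun s : Σ d : ℤ, idealGrading 𝒜 I d => (s.2 : I)) := fun b =>
  map_mem_of_isInternal (isInternal_idealGrading hI) (AddMonoidHom.id I)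
    (K := (Finsupp.linearCombination B
      fun s : Σ d : ℤ, idealGrading 𝒜 I d => (s.2 : I)).toAddMonoidHom.range)
    (fun d b hb => ⟨Finsupp.single ⟨d, b, hb⟩ 1,
      (Finsupp.linearCombination_single B _ _).trans (one_smul B b)⟩) b

variable (I) in
/-- The map `B → B / I`, where `B` is written as `PUnit →₀ B`. -/
noncomputable def punitAug : (PUnit.{u + 1} →₀ B) →ₗ[B] B ⧸ I :=
  I.mkQ ∘ₗ Finsupp.lapply PUnit.unit

theorem exact_idealCover_punitAug (hI : I.IsHomogeneous 𝒜) :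
    Function.Exact (idealCover 𝒜 I) (punitAug I) := by
  intro y
  rw [punitAug, LinearMap.comp_apply, Finsupp.lapply_apply, Submodule.mkQ_apply,
    Submodule.Quotient.mk_eq_zero]
  constructor
  · intro hy
    obtain ⟨z, hz⟩ := linearCombination_idealGrading_surjective 𝒜 hI ⟨_, hy⟩
    refine ⟨z, ?_⟩
    rw [idealCover, LinearMap.comp_apply, hz]
    exact Finsupp.unique_single y |>.symm
  · rintro ⟨z, rfl⟩
    simp [idealCover]

/-- The resolution of `B / I` which starts with `B` and continues with the canonical resolution
of `I`. -/
noncomputable def idealRes (hI : I.IsHomogeneous 𝒜) : FreeRes 𝒜 I where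
  ι
    | 0 => PEmpty
    | 1 => PUnit
    | p + 2 => (resStage 𝒜 (idealGrading 𝒜 I) p).ι
  deg
    | 0 => fun _ => 0
    | 1 => fun _ => 0
    | p + 2 => (resStage 𝒜 (idealGrading 𝒜 I) p).deg
  d
    | 0 => 0
    | 1 => idealCover 𝒜 I
    | p + 2 => resDiff 𝒜 (idealGrading 𝒜 I) p
  aug := punitAug I
  isEmpty_zero := inferInstanceAs (IsEmpty PEmpty)
  isGradedMap_d
    | 0 => fun _ => zero_mem _
    | 1 => isGradedMap_idealCover 𝒜 I
    | p + 2 => isGradedMap_diff 𝒜 (resStage 𝒜 (idealGrading 𝒜 I) p)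
  aug_mem t := ⟨1, (SetLike.GradedOne.one_mem : (1 : B) ∈ 𝒜 0), by simp [punitAug]⟩
  aug_lift := by
    rintro e _ ⟨b, hb, rfl⟩
    exact ⟨Finsupp.single PUnit.unit b,
      single_mem_finGrading (gr := fun d => (𝒜 d).toAddSubgroup) ((sub_zero e).symm ▸ hb),
      by simp [punitAug]⟩
  exact_aug := exact_idealCover_punitAug 𝒜 hI
  exact_d
    | 0 => exact_resDiff_idealCover 𝒜 hI
    | p + 1 => exact_resDiff 𝒜 (isInternal_idealGrading hI) p

variable {𝒜}

theorem quotientRes_torVanish (h𝒜 : ∀ d < 0, 𝒜 d = ⊥) (h0 : 𝒜 0 = 1) (hI : I.IsHomogeneous 𝒜)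
    {p : ℕ} {e : ℤ} (h : torGrading 𝒜 (quotientGrading 𝒜 I) p e = ⊥) :
    (quotientRes 𝒜 I hI).TorVanish (residueGrading 𝒜) p e := by
  have := gradedSMul_residueGrading h𝒜
  refine FreeRes.torVanish_of_forall_mem_range _ (isInternal_residueGrading 𝒜) fun y hy hy0 =>
    mem_range_coefMap_resDiff (ℳ := quotientGrading 𝒜 I) (p := p) h𝒜 h0 h hy ?_
  cases p with
  | zero => exact Submodule.mem_top
  | succ p => exact finsuppScalarLeft_symm_mem_torCycles hy0

theorem idealRes_torVanish_of_quotient (h𝒜 : ∀ d < 0, 𝒜 d = ⊥) (h0 : 𝒜 0 = 1)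
    (hI : I.IsHomogeneous 𝒜) {p : ℕ} {e : ℤ}
    (h : torGrading 𝒜 (quotientGrading 𝒜 I) p e = ⊥) :
    (idealRes 𝒜 hI).TorVanish (residueGrading 𝒜) p e := by
  have := gradedSMul_residueGrading h𝒜
  exact FreeRes.TorVanish.of_freeRes _ (isInternal_residueGrading 𝒜)
    (quotientRes_torVanish h𝒜 h0 hI h)

theorem idealRes_torVanish_add_two (h𝒜 : ∀ d < 0, 𝒜 d = ⊥) (h0 : 𝒜 0 = 1)
    (hI : I.IsHomogeneous 𝒜) {p : ℕ} {e : ℤ}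
    (h : torGrading 𝒜 (idealGrading 𝒜 I) (p + 1) e = ⊥) :
    (idealRes 𝒜 hI).TorVanish (residueGrading 𝒜) (p + 2) e := by
  have := gradedSMul_residueGrading h𝒜
  exact FreeRes.torVanish_of_forall_mem_range _ (isInternal_residueGrading 𝒜) fun y hy hy0 =>
    mem_range_coefMap_resDiff (ℳ := idealGrading 𝒜 I) (p := p + 1) h𝒜 h0 h hy
      (finsuppScalarLeft_symm_mem_torCycles hy0)

end CanonicalRes

/-! ### The double complex of a free resolution and a Čech complex -/

section Subquot

variable {k : Type w} [Field k] {B : Type u} [CommRing B] [Algebra k B]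
  {𝒜 : ℤ → Submodule k B} {X : Type*} [AddCommGroup X] [Module B X] {gr : ℤ → AddSubgroup X}
  {Z D : Submodule B X}

instance gradedSMul_subquotGrading [SetLike.GradedSMul 𝒜 gr] :
    SetLike.GradedSMul 𝒜 (subquotGrading gr Z D) where
  smul_mem := by
    rintro a d b _ hb ⟨y, hy, rfl⟩
    exact ⟨b • y, grSmul_mem 𝒜 gr (m := (y : X)) hb hy, map_smul (D.submoduleOf Z).mkQ b y⟩

theorem exists_mkQ_eq_of_mem_finGrading {ι : Type*} {deg : ι → ℤ} {e : ℤ}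
    {y : ι →₀ Subquot Z D} (hy : y ∈ finGrading deg (subquotGrading gr Z D) e) :
    ∃ z : ι →₀ Z, Finsupp.mapRange.linearMap Z.subtype z ∈ finGrading deg gr e ∧
      Finsupp.mapRange.linearMap (D.submoduleOf Z).mkQ z = y := by
  obtain ⟨z, hz, hzy⟩ := exists_mapRange_eq_of_mem_finGrading_map (D.submoduleOf Z).mkQ hy
  exact ⟨z, hz, hzy⟩

theorem mapRange_mkQ_eq_zero_iff {ι : Type*} {y : ι →₀ Z} :
    Finsupp.mapRange.linearMap (D.submoduleOf Z).mkQ y = 0 ↔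
      ∀ s, Finsupp.mapRange.linearMap Z.subtype y s ∈ D :=
  Finsupp.ext_iff.trans (forall_congr' fun _ => Submodule.Quotient.mk_eq_zero _)

theorem FreeRes.TorVanish.exists_sub_mem {I : Ideal B} {G : FreeRes 𝒜 I} {p : ℕ} {e : ℤ}
    (hG : G.TorVanish (subquotGrading gr Z D) p e) {y : G.ι (p + 1) →₀ X}
    (hy : y ∈ finGrading (G.deg (p + 1)) gr e) (hyZ : ∀ s, y s ∈ Z)
    (hyD : ∀ s, coefMap X (G.d p) y s ∈ D) :
    ∃ z ∈ finGrading (G.deg (p + 2)) gr e,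
      (∀ s, z s ∈ Z) ∧ ∀ s, (y - coefMap X (G.d (p + 1)) z) s ∈ D := by
  obtain ⟨y, hye, rfl⟩ := exists_mapRange_eq_of_mem_finGrading_map (gr := fun d =>
    (gr d).comap Z.subtype.toAddMonoidHom) Z.subtype (fun s => ⟨⟨y s, hyZ s⟩, hy s, rfl⟩)
  obtain ⟨z, hz, hzy⟩ := hG (Finsupp.mapRange.linearMap (D.submoduleOf Z).mkQ y)
    (fun s => ⟨y s, hye s, rfl⟩)
    (by rwa [← mapRange_coefMap, mapRange_mkQ_eq_zero_iff, mapRange_coefMap])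
  obtain ⟨z, hze, rfl⟩ := exists_mkQ_eq_of_mem_finGrading hz
  refine ⟨_, hze, fun s => (z s).2, ?_⟩
  rw [← mapRange_coefMap, ← map_sub, ← mapRange_mkQ_eq_zero_iff, map_sub, mapRange_coefMap, hzy,
    sub_self]

end Subquot

section Staircase

variable {k : Type w} [Field k] {B : Type u} [CommRing B] [Algebra k B]
  {𝒜 : ℤ → Submodule k B} {r : ℕ} {x : Fin r → B} {I : Ideal B} (G : FreeRes 𝒜 I)
  {M : Type v} [AddCommGroup M] [Module B M]

theorem FreeRes.mem_range_coefMap_cechLoc (hxI : ∀ a, ∃ K : ℕ, x a ^ K ∈ I) {S : Finset (Fin r)}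
    (hS : S.Nonempty) {p : ℕ} {y : G.ι (p + 1) →₀ CechLoc x M S}
    (hy : coefMap _ (G.d p) y = 0) : y ∈ LinearMap.range (coefMap _ (G.d (p + 1))) := by
  obtain ⟨a, ha⟩ := hS
  obtain ⟨K, hK⟩ := hxI a
  exact G.mem_range_coefMap_of_isUnit hK (IsLocalizedModule.map_units
    (LocalizedModule.mkLinearMap (cechMonoid x S) M) ⟨_, pow_mem (mem_cechMonoid x ha) K⟩) hy

theorem FreeRes.mem_range_coefMap_cech (hxI : ∀ a, ∃ K : ℕ, x a ^ K ∈ I) {p q : ℕ}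
    {y : G.ι (p + 1) →₀ Cech x M (q + 1)} (hy : coefMap _ (G.d p) y = 0) :
    y ∈ LinearMap.range (coefMap _ (G.d (p + 1))) := by
  classical
  have hex (S : {S : Finset (Fin r) // S.card = q + 1}) :
      Finsupp.mapRange.linearMap (LinearMap.proj (R := B)
        (φ := fun S : {S : Finset (Fin r) // S.card = q + 1} => CechLoc x M S.1) S) y ∈
      LinearMap.range (coefMap _ (G.d (p + 1))) :=
    G.mem_range_coefMap_cechLoc hxI (Finset.card_pos.1 (q.succ_pos.trans_eq S.2.symm))
      (by rw [← mapRange_coefMap, hy, map_zero])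
  choose z hz using hex
  refine ⟨∑ S, Finsupp.mapRange.linearMap (LinearMap.single B
    (fun S : {S : Finset (Fin r) // S.card = q + 1} => CechLoc x M S.1) S) (z S), ?_⟩
  simp only [map_sum, ← mapRange_coefMap, hz]
  ext s : 1
  rw [Finsupp.finsetSum_apply]
  exact Finset.univ_sum_single (y s)

theorem mapRange_cechDiff_cechDiff {ι : Type*} {p : ℕ} (y : ι →₀ Cech x M p) :
    Finsupp.mapRange.linearMap (cechDiff x M (p + 1))
      (Finsupp.mapRange.linearMap (cechDiff x M p) y) = 0 :=
  Finsupp.ext fun s => cechBoundaries_le_ker x (p + 1) ⟨y s, rfl⟩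

theorem exists_pow_smul_locCoh_eq_zero [IsNoetherianRing B] (hx : IsCechFamily 𝒜 x) {p : ℕ}
    (y : LocCoh x M p) : ∃ K : ℕ, ∀ b ∈ irrelevantIdeal 𝒜 ^ K, b • y = 0 := by
  have hle : irrelevantIdeal 𝒜 ≤ (Ideal.torsionOf B _ y).radical := by
    rw [← hx.radical_eq, Ideal.radical_le_radical_iff, Ideal.span_le]
    rintro _ ⟨a, rfl⟩
    obtain ⟨⟨α, hα⟩, rfl⟩ := Submodule.mkQ_surjective _ y
    obtain ⟨K, hK⟩ := exists_pow_smul_mem_cechBoundaries x a p α hα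
    refine ⟨K, ?_⟩
    rw [Ideal.mem_torsionOf_iff, ← map_smul]
    exact (Submodule.Quotient.mk_eq_zero _).2 hK
  obtain ⟨K, hK⟩ := Ideal.exists_pow_le_of_le_radical_of_fg hle (IsNoetherian.noetherian _)
  exact ⟨K, fun b hb => (Ideal.mem_torsionOf_iff y b).1 (hK hb)⟩

theorem coefMap_apply_mem_smul_top {ι κ : Type*} (φ : (ι →₀ B) →ₗ[B] (κ →₀ B)) {s : κ}
    (hφ : ∀ t, φ (Finsupp.single t 1) s ∈ I) (y : ι →₀ M) :
    coefMap M φ y s ∈ I • (⊤ : Submodule B M) := by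
  rw [coefMap_apply]
  exact sum_mem fun t _ => Submodule.smul_mem_smul (hφ t) Submodule.mem_top

theorem cechMonoid_empty : cechMonoid x ∅ = ⊥ := by
  rw [cechMonoid, Finset.coe_empty, Set.image_empty, Submonoid.closure_empty]

theorem mkLinearMap_cechMonoid_empty_bijective :
    Function.Bijective (LocalizedModule.mkLinearMap (cechMonoid x ∅) M) := by
  have := IsLocalization.self (cechMonoid_empty (x := x).trans_le bot_le)
  have := isLocalizedModule_id (cechMonoid x ∅) M B
  convert (IsLocalizedModule.linearEquiv (cechMonoid x ∅) LinearMap.id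
    (LocalizedModule.mkLinearMap (cechMonoid x ∅) M)).bijective
  ext m
  exact (IsLocalizedModule.linearEquiv_apply (cechMonoid x ∅) LinearMap.id _ m).symm

variable (x M) in
/-- The isomorphism of `M` with the Čech cochains of degree `0`. -/
noncomputable def cechZero : M →ₗ[B] Cech x M 0 :=
  LinearMap.pi fun S => LocalizedModule.mkLinearMap (cechMonoid x S.1) M

theorem cechZero_injective : Function.Injective (cechZero x M) := fun _ _ h =>
  mkLinearMap_cechMonoid_empty_bijective.1 (congrFun h ⟨∅, rfl⟩)

theorem cechZero_surjective : Function.Surjective (cechZero x M) := by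
  intro α
  obtain ⟨m, hm⟩ := mkLinearMap_cechMonoid_empty_bijective.2 (α ⟨∅, rfl⟩)
  refine ⟨m, funext fun ⟨S, hS⟩ => ?_⟩
  obtain rfl := Finset.card_eq_zero.1 hS
  exact hm

variable [GradedAlgebra 𝒜] (ℳ : ℤ → AddSubgroup M) [SetLike.GradedSMul 𝒜 ℳ]

theorem mapRange_cechDiff_mem {ι : Type*} {deg : ι → ℤ} {p : ℕ} {e : ℤ} {y : ι →₀ Cech x M p}
    (hy : y ∈ finGrading deg (cechGrading x 𝒜 ℳ p) e) :
    Finsupp.mapRange.linearMap (cechDiff x M p) y ∈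
      finGrading deg (cechGrading x 𝒜 ℳ (p + 1)) e :=
  fun s => cechDiff_mem_cechGrading 𝒜 ℳ (hy s)

theorem FreeRes.exists_staircase (hx : ∀ a, ∃ d : ℤ, x a ∈ 𝒜 d) (h : IsInternal ℳ)
    (hxI : ∀ a, ∃ K : ℕ, x a ^ K ∈ I) {e : ℤ} {y : G.ι 1 →₀ Cech x M 0}
    (hy : y ∈ finGrading (G.deg 1) (cechGrading x 𝒜 ℳ 0) e) :
    ∃ Y : ∀ q, G.ι (q + 1) →₀ Cech x M q, Y 0 = y ∧
      (∀ q, Y q ∈ finGrading (G.deg (q + 1)) (cechGrading x 𝒜 ℳ q) e) ∧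
      ∀ q, coefMap _ (G.d (q + 1)) (Y (q + 1)) =
        Finsupp.mapRange.linearMap (cechDiff x M q) (Y q) := by
  have := G.isEmpty_zero
  obtain ⟨Y, hY0, hY, hYd⟩ := exists_seq (α := fun q => G.ι (q + 1) →₀ Cech x M q)
    (P := fun q y => y ∈ finGrading (G.deg (q + 1)) (cechGrading x 𝒜 ℳ q) e ∧
      coefMap _ (G.d q) (Finsupp.mapRange.linearMap (cechDiff x M q) y) = 0)
    (R := fun q y y' => coefMap _ (G.d (q + 1)) y' =
      Finsupp.mapRange.linearMap (cechDiff x M q) y) y ⟨hy, Subsingleton.elim _ _⟩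
    fun q y ⟨hye, hy0⟩ => by
      obtain ⟨z, hz⟩ := G.mem_range_coefMap_cech hxI hy0
      obtain ⟨z', hz', hzz'⟩ := (G.isGradedMap_d (q + 1)).exists_homogeneous_coefMap_eq
        (cechGrading x 𝒜 ℳ (q + 1)) (isInternal_cechGrading 𝒜 ℳ hx h (q + 1))
        (hz ▸ mapRange_cechDiff_mem ℳ hye)
      rw [hz] at hzz'
      exact ⟨z', ⟨hz', by rw [← mapRange_coefMap, hzz', mapRange_cechDiff_cechDiff]⟩, hzz'⟩
  exact ⟨Y, hY0, fun q => (hY q).1, hYd⟩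

variable {G ℳ}

theorem exists_mapRange_cechDiff_eq (hx : ∀ a, ∃ d : ℤ, x a ∈ 𝒜 d) (h : IsInternal ℳ)
    {ι : Type*} {deg : ι → ℤ} {q : ℕ} {e : ℤ} {y : ι →₀ Cech x M (q + 1)}
    (hy : y ∈ finGrading deg (cechGrading x 𝒜 ℳ (q + 1)) e)
    (hyb : ∀ s, y s ∈ cechBoundaries x M (q + 1)) :
    ∃ z ∈ finGrading deg (cechGrading x 𝒜 ℳ q) e,
      Finsupp.mapRange.linearMap (cechDiff x M q) z = y := by
  refine exists_mapRange_eq_of_mem_finGrading_map (cechDiff x M q) fun s => ?_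
  obtain ⟨c, hc⟩ := hyb s
  rw [← hc]
  exact exists_homogeneous_preimage (isInternal_cechGrading 𝒜 ℳ hx h q)
    (isInternal_cechGrading 𝒜 ℳ hx h (q + 1)) (cechDiff x M q).toAddMonoidHom
    (fun d _ hz => cechDiff_mem_cechGrading 𝒜 ℳ hz) (hc ▸ hy s)

theorem FreeRes.TorVanish.exists_staircase_correction (hx : ∀ a, ∃ d : ℤ, x a ∈ 𝒜 d)
    (h : IsInternal ℳ) {q : ℕ} {e : ℤ}
    (hG : G.TorVanish (locCohGrading 𝒜 ℳ x (q + 1)) (q + 1) e)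
    {y : G.ι (q + 1) →₀ Cech x M q} {u : G.ι (q + 2) →₀ Cech x M (q + 1)}
    (hu : u ∈ finGrading (G.deg (q + 2)) (cechGrading x 𝒜 ℳ (q + 1)) e)
    (huy : coefMap _ (G.d (q + 1)) u = Finsupp.mapRange.linearMap (cechDiff x M q) y)
    (hu0 : Finsupp.mapRange.linearMap (cechDiff x M (q + 1)) u = 0) :
    ∃ z ∈ finGrading (G.deg (q + 2)) (cechGrading x 𝒜 ℳ q) e,
      Finsupp.mapRange.linearMap (cechDiff x M q) (y - coefMap _ (G.d (q + 1)) z) = 0 := by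
  obtain ⟨w, hw, -, hwb⟩ := hG.exists_sub_mem hu (fun s => DFunLike.congr_fun hu0 s)
    fun s => huy ▸ ⟨y s, rfl⟩
  obtain ⟨z, hz, hzu⟩ := exists_mapRange_cechDiff_eq hx h
    (sub_mem hu ((G.isGradedMap_d (q + 2)).coefMap_mem _ hw)) hwb
  refine ⟨z, hz, ?_⟩
  rw [map_sub, mapRange_coefMap, hzu, map_sub, huy, coefMap_coefMap, G.d_comp_d, map_zero,
    LinearMap.zero_apply, sub_zero, sub_self]

theorem subsingleton_cech_of_lt {q : ℕ} (hq : r < q) : Subsingleton (Cech x M q) := by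
  have : IsEmpty {S : Finset (Fin r) // S.card = q} :=
    ⟨fun S => hq.not_ge (S.2 ▸ (Finset.card_le_univ S.1).trans_eq (Fintype.card_fin r))⟩
  infer_instance

theorem FreeRes.mem_range_coefMap_cech_zero (hx : ∀ a, ∃ d : ℤ, x a ∈ 𝒜 d)
    (h : IsInternal ℳ) (hxI : ∀ a, ∃ K : ℕ, x a ^ K ∈ I) {e : ℤ}
    (hG : ∀ p, G.TorVanish (locCohGrading 𝒜 ℳ x p) p e) {y : G.ι 1 →₀ Cech x M 0}
    (hy : y ∈ finGrading (G.deg 1) (cechGrading x 𝒜 ℳ 0) e) :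
    y ∈ LinearMap.range (coefMap _ (G.d 1)) := by
  obtain ⟨Y, rfl, hY, hYd⟩ := G.exists_staircase ℳ hx h hxI hy
  have hcorr {q : ℕ} (hq : q ≤ r) :
      ∃ z ∈ finGrading (G.deg (q + 2)) (cechGrading x 𝒜 ℳ q) e,
        Finsupp.mapRange.linearMap (cechDiff x M q) (Y q - coefMap _ (G.d (q + 1)) z) = 0 := by
    induction hq using Nat.decreasingInduction with
    | self =>
      have := subsingleton_cech_of_lt (x := x) (M := M) r.lt_succ_self
      exact ⟨0, zero_mem _, Subsingleton.elim _ _⟩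
    | of_succ q _ ih =>
      obtain ⟨z, hz, hz0⟩ := ih
      refine (hG (q + 1)).exists_staircase_correction hx h
        (sub_mem (hY (q + 1)) ((G.isGradedMap_d (q + 2)).coefMap_mem _ hz)) ?_ hz0
      rw [map_sub, hYd, coefMap_coefMap, G.d_comp_d, map_zero, LinearMap.zero_apply, sub_zero]
  obtain ⟨z, hz, hz0⟩ := hcorr r.zero_le
  have := G.isEmpty_zero
  obtain ⟨w, -, -, hw⟩ := (hG 0).exists_sub_mem
    (sub_mem hy ((G.isGradedMap_d 1).coefMap_mem _ hz)) (fun s => DFunLike.congr_fun hz0 s)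
    isEmptyElim
  refine ⟨z + w, ?_⟩
  have hsum : Y 0 - coefMap _ (G.d 1) z - coefMap _ (G.d 1) w = 0 :=
    Finsupp.ext fun s => (Submodule.mem_bot B).1 (hw s)
  rw [map_add, eq_comm, ← sub_eq_zero, ← sub_sub, hsum]

theorem cechZero_mem_cechGrading {e : ℤ} {m : M} (hm : m ∈ ℳ e) :
    cechZero x M m ∈ cechGrading x 𝒜 ℳ 0 e :=
  (mem_cechGrading 𝒜 ℳ).2 fun _ =>
    mk_mem_locGrading 𝒜 ℳ (s := 1) SetLike.GradedOne.one_mem hm (zero_add e).symm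

theorem mem_ideal_smul_top_of_torVanish [IsNoetherianRing B] (hx : IsCechFamily 𝒜 x)
    (h𝒜 : ∀ d < 0, 𝒜 d = ⊥) (h0 : 𝒜 0 = 1) (hI : I.IsHomogeneous 𝒜)
    (hxI : ∀ a, ∃ K : ℕ, x a ^ K ∈ I) (h : IsInternal ℳ) {e : ℤ}
    (hH : ∀ p d, locCohGrading 𝒜 ℳ x p d ≠ ⊥ →
      (idealRes 𝒜 hI).TorVanish (residueGrading 𝒜) p (e - d))
    {m : M} (hm : m ∈ ℳ e) : m ∈ I • (⊤ : Submodule B M) := by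
  let t : (idealRes 𝒜 hI).ι 1 := (PUnit.unit : PUnit.{u + 1})
  have ht : (idealRes 𝒜 hI).deg 1 t = 0 := rfl
  have hdt (s : (idealRes 𝒜 hI).ι 2) : (idealRes 𝒜 hI).d 1 (Finsupp.single s 1) t ∈ I :=
    idealCover_apply_mem 𝒜 _ t
  obtain ⟨z, hz⟩ := (idealRes 𝒜 hI).mem_range_coefMap_cech_zero hx.homogeneous h hxI
    (fun p => FreeRes.torVanish_of_torsion _ h𝒜 h0 (exists_pow_smul_locCoh_eq_zero hx) (hH p))
    (y := Finsupp.single t (cechZero x M m))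
    (single_mem_finGrading (by rw [ht, sub_zero]; exact cechZero_mem_cechGrading hm))
  have hmem := coefMap_apply_mem_smul_top ((idealRes 𝒜 hI).d 1) hdt z
  rw [hz, Finsupp.single_eq_same, ← LinearMap.range_eq_top.2 cechZero_surjective,
    ← Submodule.map_top, ← Submodule.map_smul''] at hmem
  exact (cechZero_injective.mem_set_image).1 hmem

end Staircase

/-! ### Graded local cohomology and short exact sequences -/

section GradedLocCoh

variable {k : Type w} [Field k] {B : Type u} [CommRing B] [Algebra k B]
  {𝒜 : ℤ → Submodule k B} [GradedAlgebra 𝒜] {r : ℕ} {x : Fin r → B}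

section ShortExact

variable {A M Q : Type*} [AddCommGroup A] [Module B A] [AddCommGroup M] [Module B M]
  [AddCommGroup Q] [Module B Q] {gA : ℤ → AddSubgroup A} {gM : ℤ → AddSubgroup M}
  {gQ : ℤ → AddSubgroup Q} [SetLike.GradedSMul 𝒜 gA] [SetLike.GradedSMul 𝒜 gM]
  [SetLike.GradedSMul 𝒜 gQ]

theorem locCohGrading_succ_eq_bot_of_exact (hx : ∀ a, ∃ d : ℤ, x a ∈ 𝒜 d)
    (hM : IsInternal gM) {f : A →ₗ[B] M} {g : M →ₗ[B] Q} (hf : Function.Injective f)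
    (hg : Function.Surjective g) (h : Function.Exact f g) (hfgr : ∀ d, ∀ z ∈ gA d, f z ∈ gM d)
    (hggr : ∀ d, ∀ z ∈ gM d, g z ∈ gQ d) {p : ℕ} {e : ℤ} (hQe : locCohGrading 𝒜 gQ x p e = ⊥)
    (hMe : locCohGrading 𝒜 gM x (p + 1) e = ⊥) : locCohGrading 𝒜 gA x (p + 1) e = ⊥ := by
  rw [subquotGrading_eq_bot_iff] at hQe hMe ⊢
  intro α hα0 hα
  have hfα := cechMap_mem_cechGrading 𝒜 gA gM hfgr hα
  obtain ⟨β, hβ⟩ := hMe _ (by rw [LinearMap.mem_ker, cechDiff_cechMap, hα0, map_zero]) hfα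
  obtain ⟨γ, hγ, hγβ⟩ := exists_homogeneous_preimage (isInternal_cechGrading 𝒜 gM hx hM p)
    (isInternal_cechGrading 𝒜 gM hx hM (p + 1)) (cechDiff x M p).toAddMonoidHom
    (fun d _ hz => cechDiff_mem_cechGrading 𝒜 gM hz) (hβ ▸ hfα)
  have hγα : cechDiff x M p γ = cechMap x f (p + 1) α := hγβ.trans hβ
  refine mem_cechBoundaries_of_connecting x hf hg h hγα
    (hQe _ ?_ (cechMap_mem_cechGrading 𝒜 gM gQ hggr hγ))
  rw [LinearMap.mem_ker, cechDiff_cechMap, hγα, (cechMap_exact x h _).apply_apply_eq_zero]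

theorem locCohGrading_zero_eq_bot_of_injective {f : A →ₗ[B] M} (hf : Function.Injective f)
    (hfgr : ∀ d, ∀ z ∈ gA d, f z ∈ gM d) {e : ℤ} (hM : locCohGrading 𝒜 gM x 0 e = ⊥) :
    locCohGrading 𝒜 gA x 0 e = ⊥ := by
  rw [subquotGrading_eq_bot_iff] at hM ⊢
  intro α hα0 hα
  have hfα := hM (cechMap x f 0 α) (by rw [LinearMap.mem_ker, cechDiff_cechMap, hα0, map_zero])
    (cechMap_mem_cechGrading 𝒜 gA gM hfgr hα)
  exact (map_eq_zero_iff _ (cechMap_injective x hf 0)).1 hfα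

theorem locCohGrading_zero_eq_bot {e : ℤ} (he : gM e = ⊥) : locCohGrading 𝒜 gM x 0 e = ⊥ := by
  refine subquotGrading_eq_bot_iff.2 fun α _ hα => funext fun S => ?_
  obtain ⟨a, m, ⟨s, hS⟩, hs, hm, hmk⟩ := (mem_cechGrading 𝒜 gM).1 hα S
  obtain rfl : s = 1 := by
    rwa [Finset.card_eq_zero.1 S.2, cechMonoid_empty, Submonoid.mem_bot] at hS
  suffices m = 0 by rw [hmk, this, LocalizedModule.zero_mk]; rfl
  by_cases h1 : (1 : B) = 0
  · rw [← one_smul B m, h1, zero_smul]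
  · obtain rfl := DirectSum.degree_eq_of_mem_mem 𝒜 hs SetLike.GradedOne.one_mem h1
    rwa [zero_add, he, AddSubgroup.mem_bot] at hm

end ShortExact

variable {X Y : Type*} [AddCommGroup X] [Module B X] [AddCommGroup Y] [Module B Y]

/-- The grading which a submodule inherits. -/
def subGrading (gr : ℤ → AddSubgroup X) (Z : Submodule B X) (d : ℤ) : AddSubgroup Z :=
  (gr d).comap Z.subtype.toAddMonoidHom

instance gradedSMul_subGrading (gr : ℤ → AddSubgroup X) [SetLike.GradedSMul 𝒜 gr]
    (Z : Submodule B X) : SetLike.GradedSMul 𝒜 (subGrading gr Z) where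
  smul_mem := fun _ _ _ z hb hz => grSmul_mem 𝒜 gr (m := (z : X)) hb hz

variable {gr : ℤ → AddSubgroup X} {gr' : ℤ → AddSubgroup Y}

theorem isInternal_subGrading_ker (h : IsInternal gr) (h' : IsInternal gr')
    (f : X →ₗ[B] Y) (hf : ∀ d, ∀ z ∈ gr d, f z ∈ gr' d) :
    IsInternal (subGrading gr (LinearMap.ker f)) :=
  isInternal_comap_ker h h' f.toAddMonoidHom hf

variable [SetLike.GradedSMul 𝒜 gr] [SetLike.GradedSMul 𝒜 gr']

theorem locCohGrading_ker_succ_eq_bot (hx : ∀ a, ∃ d : ℤ, x a ∈ 𝒜 d)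
    (h : IsInternal gr) (f : X →ₗ[B] Y) (hf : ∀ d, ∀ z ∈ gr d, f z ∈ gr' d) {p : ℕ}
    {e : ℤ} (hR : locCohGrading 𝒜 (subGrading gr' (LinearMap.range f)) x p e = ⊥)
    (hX : locCohGrading 𝒜 gr x (p + 1) e = ⊥) :
    locCohGrading 𝒜 (subGrading gr (LinearMap.ker f)) x (p + 1) e = ⊥ := by
  refine locCohGrading_succ_eq_bot_of_exact hx h (LinearMap.ker f).subtype_injective
    f.surjective_rangeRestrict ?_ (fun _ _ hz => hz) hf hR hX
  rw [LinearMap.exact_iff, LinearMap.ker_rangeRestrict, Submodule.range_subtype]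

theorem locCohGrading_succ_eq_bot_of_subquot (hx : ∀ a, ∃ d : ℤ, x a ∈ 𝒜 d)
    {Z D : Submodule B X} (hDZ : D ≤ Z) (hZ : IsInternal (subGrading gr Z)) {p : ℕ}
    {e : ℤ} (hQe : locCohGrading 𝒜 (subquotGrading gr Z D) x p e = ⊥)
    (hZe : locCohGrading 𝒜 (subGrading gr Z) x (p + 1) e = ⊥) :
    locCohGrading 𝒜 (subGrading gr D) x (p + 1) e = ⊥ := by
  refine locCohGrading_succ_eq_bot_of_exact (gQ := subquotGrading gr Z D) hx hZ
    (Submodule.inclusion_injective hDZ) (Submodule.mkQ_surjective (D.submoduleOf Z)) ?_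
    (fun _ _ hz => hz) (fun d z hz => ⟨z, hz, rfl⟩) hQe hZe
  rw [LinearMap.exact_iff, Submodule.ker_mkQ, Submodule.range_inclusion]
  rfl

end GradedLocCoh

/-! ### The cycles and the homology of a complex -/

section Complex

variable {k : Type w} [Field k] {B : Type u} [CommRing B] [Algebra k B]
  {𝒜 : ℤ → Submodule k B} {r : ℕ} {x : Fin r → B} {L : ChainComplex (ModuleCat.{v} B) ℤ}
  {ℒ : (j : ℤ) → ℤ → AddSubgroup (L.X j)}

theorem boundaries_le_cycles (j : ℤ) : boundaries L j ≤ cycles L j := by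
  rintro _ ⟨y, rfl⟩
  exact congrArg (fun f => f.hom y) (L.d_comp_d (j + 1) j (j - 1))

theorem boundaries_sub_one (j : ℤ) :
    boundaries L (j - 1) = LinearMap.range (L.d j (j - 1)).hom := by
  rw [boundaries]
  have h : ∀ a, a = j - 1 + 1 → LinearMap.range (L.d a (j - 1)).hom = boundaries L (j - 1) := by
    rintro _ rfl
    rfl
  exact (h j (by ring)).symm

variable (L ℒ) in
/-- The grading of `H_j(L)` induced by the grading of `L_j`. -/
noncomputable abbrev homologyGrading (j e : ℤ) : AddSubgroup (Homology L j) :=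
  subquotGrading (ℒ j) (cycles L j) (boundaries L j) e

theorem isInternal_cycles (h : ∀ j, IsInternal (ℒ j))
    (hd : ∀ a b d : ℤ, ∀ y ∈ ℒ a d, (L.d a b).hom y ∈ ℒ b d) (j : ℤ) :
    IsInternal (subGrading (ℒ j) (cycles L j)) :=
  isInternal_subGrading_ker (h j) (h (j - 1)) _ (hd j (j - 1))

variable [GradedAlgebra 𝒜] [∀ j, SetLike.GradedSMul 𝒜 (ℒ j)]

theorem locCohGrading_cycles_eq_bot (hx : ∀ a, ∃ d : ℤ, x a ∈ 𝒜 d)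
    (h : ∀ j, IsInternal (ℒ j))
    (hd : ∀ a b d : ℤ, ∀ y ∈ ℒ a d, (L.d a b).hom y ∈ ℒ b d) {j d : ℤ} {p : ℕ}
    (hdepth : ∀ j' < j, ∀ q < p, Subsingleton (LocCoh x (L.X j') q))
    (htors : ∀ j' < j, ∀ (a : Fin r) (y : Homology L j'), ∃ K : ℕ, x a ^ K • y = 0)
    (hL : locCohGrading 𝒜 (ℒ j) x p d = ⊥)
    (hH : ∀ j' < j, j' + p = j + 1 → homologyGrading L ℒ j' d = ⊥) :
    locCohGrading 𝒜 (subGrading (ℒ j) (cycles L j)) x p d = ⊥ := by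
  induction p generalizing j with
  | zero =>
    exact locCohGrading_zero_eq_bot_of_injective (cycles L j).subtype_injective
      (fun _ _ hz => hz) hL
  | succ p ih =>
    refine locCohGrading_ker_succ_eq_bot hx (h j) _ (hd j (j - 1)) ?_ hL
    rw [← boundaries_sub_one]
    have hpred : locCohGrading 𝒜 (ℒ (j - 1)) x p d = ⊥ :=
      have := hdepth (j - 1) (by omega) p p.lt_succ_self
      Subsingleton.elim _ _
    cases p with
    | zero =>
      exact locCohGrading_zero_eq_bot_of_injective (boundaries L (j - 1)).subtype_injective
        (fun _ _ hz => hz) hpred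
    | succ q =>
      refine locCohGrading_succ_eq_bot_of_subquot hx (boundaries_le_cycles (j - 1))
        (isInternal_cycles h hd (j - 1)) ?_
        (ih (fun j' hj' q' hq' => hdepth j' (by omega) q' (by omega))
          (fun j' hj' => htors j' (by omega)) hpred
          fun j' hj' hq => hH j' (by omega) (by push_cast at hq ⊢; omega))
      cases q with
      | zero => exact locCohGrading_zero_eq_bot (hH (j - 1) (by omega) (by push_cast; ring))
      | succ q =>
        have := subsingleton_cech_succ x (htors (j - 1) (by omega)) q
        exact Subsingleton.elim _ _

theorem homologyGrading_eq_bot_of_torVanish [IsNoetherianRing B] (hx : IsCechFamily 𝒜 x)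
    (h𝒜 : ∀ d < 0, 𝒜 d = ⊥) (h0 : 𝒜 0 = 1) {I : Ideal B} (hI : I.IsHomogeneous 𝒜)
    (hxI : ∀ a, ∃ K : ℕ, x a ^ K ∈ I) (h : ∀ j, IsInternal (ℒ j))
    (hd : ∀ a b d : ℤ, ∀ y ∈ ℒ a d, (L.d a b).hom y ∈ ℒ b d) {i e : ℤ}
    (hIH : ∀ a ∈ I, ∀ y : Homology L i, a • y = 0)
    (hTor : ∀ p d, locCohGrading 𝒜 (subGrading (ℒ i) (cycles L i)) x p d ≠ ⊥ →
      (idealRes 𝒜 hI).TorVanish (residueGrading 𝒜) p (e - d)) :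
    homologyGrading L ℒ i e = ⊥ := by
  refine subquotGrading_eq_bot_iff.2 fun y hy hye => ?_
  have hle : I • (⊤ : Submodule B (cycles L i)) ≤ (boundaries L i).submoduleOf (cycles L i) :=
    Submodule.smul_le.2 fun a ha z _ =>
      (Submodule.Quotient.mk_eq_zero _).1 (hIH a ha (Submodule.Quotient.mk z))
  exact hle (mem_ideal_smul_top_of_torVanish hx h𝒜 h0 hI hxI (isInternal_cycles h hd i) hTor
    (m := ⟨y, hy⟩) hye)

/-- The case distinction on a degree `d` of `H^p_𝔪(Z_i)`: either `p = n` and `d` is a degree of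
`H^n_𝔪(L_i)`, or `d` is a degree of `H_j` with `j = i + 1 - p`, and then
`Tor_p(B / I, k) = Tor_{i - j}(I, k)`. -/
theorem exists_degree_of_homologyGrading_ne_bot [IsNoetherianRing B] (hx : IsCechFamily 𝒜 x)
    (h𝒜 : ∀ d < 0, 𝒜 d = ⊥) (h0 : 𝒜 0 = 1) {I : Ideal B} (hI : I.IsHomogeneous 𝒜)
    (hxI : ∀ a, ∃ K : ℕ, x a ^ K ∈ I) (h : ∀ j, IsInternal (ℒ j))
    (hd : ∀ a b d : ℤ, ∀ y ∈ ℒ a d, (L.d a b).hom y ∈ ℒ b d) {i : ℤ} {n : ℕ}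
    (hn : ringKrullDim B ≤ n) (hdepth : ∀ j ≤ i, ∀ p < n, Subsingleton (LocCoh x (L.X j) p))
    (hIH : ∀ j ≤ i, ∀ a ∈ I, ∀ y : Homology L j, a • y = 0) {e : ℤ}
    (he : homologyGrading L ℒ i e ≠ ⊥) :
    (∃ d, locCohGrading 𝒜 (ℒ i) x n d ≠ ⊥ ∧ torGrading 𝒜 (quotientGrading 𝒜 I) n (e - d) ≠ ⊥) ∨
    ∃ j < i, ∃ d, homologyGrading L ℒ j d ≠ ⊥ ∧
      torGrading 𝒜 (idealGrading 𝒜 I) (i - j).toNat (e - d) ≠ ⊥ := by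
  contrapose! he
  obtain ⟨hquot, hideal⟩ := he
  refine homologyGrading_eq_bot_of_torVanish hx h𝒜 h0 hI hxI h hd (hIH i le_rfl) fun p d hpd => ?_
  have hpn : p ≤ n := by
    refine le_of_not_gt fun hlt => hpd ?_
    have := subsingleton_locCoh_of_ringKrullDim_lt x (M := cycles L i)
      (hn.trans_lt (by exact_mod_cast hlt))
    exact Subsingleton.elim _ _
  by_cases hL : locCohGrading 𝒜 (ℒ i) x p d = ⊥
  · obtain ⟨j, hji, hj, hjd⟩ : ∃ j < i, j + p = i + 1 ∧ homologyGrading L ℒ j d ≠ ⊥ := by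
      contrapose! hpd
      exact locCohGrading_cycles_eq_bot hx.homogeneous h hd
        (fun j hj q hq => hdepth j hj.le q (hq.trans_le hpn))
        (fun j hj a y => (hxI a).imp fun K hK => hIH j hj.le _ hK y) hL hpd
    obtain ⟨p, rfl⟩ := Nat.exists_eq_add_of_le' (by omega : 2 ≤ p)
    refine idealRes_torVanish_add_two h𝒜 h0 hI ?_
    have hjtor := hideal j hji d hjd
    rwa [show (i - j).toNat = p + 1 by push_cast at hj; omega] at hjtor
  · obtain rfl : p = n := by
      refine hpn.antisymm (le_of_not_gt fun hlt => hL ?_)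
      have := hdepth i le_rfl p hlt
      exact Subsingleton.elim _ _
    exact idealRes_torVanish_of_quotient h𝒜 h0 hI (hquot d hL)

end Complex

/-! ### Adding up the degrees -/

theorem irrelevantIdeal_le_radical {k : Type w} [Field k] {B : Type u} [CommRing B] [Algebra k B]
    [IsNoetherianRing B] {𝒜 : ℤ → Submodule k B} [GradedAlgebra 𝒜] (h𝒜 : ∀ d < 0, 𝒜 d = ⊥)
    {I : Ideal B} (hI : I.IsHomogeneous 𝒜) (hdim : ringKrullDim (B ⧸ I) ≤ 0) :
    irrelevantIdeal 𝒜 ≤ I.radical := by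
  have : IsArtinianRing (B ⧸ I) := isArtinianRing_iff_isNoetherianRing_krullDimLE_zero.2
    ⟨inferInstance, Ring.krullDimLE_iff.2 hdim⟩
  refine Ideal.span_le.2 ?_
  rintro b ⟨d, hd, hb⟩
  obtain ⟨N, c, hc⟩ : ∃ (N : ℕ) (c : B), b ^ (N + 1) * c - b ^ N ∈ I := by
    obtain ⟨N, c, hc⟩ := IsArtinian.exists_pow_succ_smul_dvd (Ideal.Quotient.mk I b) (1 : B ⧸ I)
    obtain ⟨c, rfl⟩ := Ideal.Quotient.mk_surjective c
    refine ⟨N, c, Ideal.Quotient.eq.1 ?_⟩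
    simpa only [map_mul, map_pow, smul_eq_mul, mul_one] using hc
  have hbN : b ^ N ∈ 𝒜 (N • d) := SetLike.pow_mem_graded N hb
  have hbc : (decompose 𝒜 (b ^ (N + 1) * c) (N • d) : B) = 0 := by
    have hc0 : (decompose 𝒜 c (-d) : B) = 0 := (Submodule.mem_bot k).1
      ((h𝒜 _ (neg_lt_zero.2 hd)).le (SetLike.coe_mem (decompose 𝒜 c (-d))))
    rw [show N • d = (N + 1) • d + -d by rw [succ_nsmul]; ring,
      DirectSum.coe_decompose_mul_add_of_left_mem 𝒜 (SetLike.pow_mem_graded (N + 1) hb), hc0,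
      mul_zero]
  have hcomp := hI (N • d) hc
  rw [DirectSum.decompose_sub, DFinsupp.sub_apply, AddSubgroupClass.coe_sub, hbc,
    DirectSum.decompose_of_mem_same 𝒜 hbN, zero_sub, neg_mem_iff] at hcomp
  exact ⟨N, hcomp⟩

theorem IsCechFamily.exists_pow_mem {k : Type w} [Field k] {B : Type u} [CommRing B] [Algebra k B]
    {𝒜 : ℤ → Submodule k B} {r : ℕ} {x : Fin r → B} (hx : IsCechFamily 𝒜 x) {I : Ideal B}
    (hI : irrelevantIdeal 𝒜 ≤ I.radical) (a : Fin r) : ∃ K : ℕ, x a ^ K ∈ I :=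
  hI (hx.radical_eq ▸ Ideal.le_radical (Ideal.subset_span ⟨a, rfl⟩))

theorem subsingleton_locCoh_of_lt_lcDepth {B : Type u} [CommRing B] {r : ℕ} {x : Fin r → B}
    {M : Type v} [AddCommGroup M] [Module B M] {p : ℕ} (h : (p : ℕ∞) < lcDepth x M) :
    Subsingleton (LocCoh x M p) :=
  not_nontrivial_iff_subsingleton.1 fun hp => h.not_ge (iInf₂_le p hp)

theorem le_gradedEnd {M : Type v} [AddCommGroup M] {gr : ℤ → AddSubgroup M} {d : ℤ}
    (h : gr d ≠ ⊥) : ((d : ℝ) : EReal) ≤ gradedEnd gr :=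
  le_iSup₂ (f := fun (d : ℤ) (_ : gr d ≠ ⊥) => ((d : ℝ) : EReal)) d h

/-- The degree bookkeeping of the induction: `H j e` says that `e` is a degree of `H_j`, and a
degree either stops at a degree of `N j` plus one of `T`, or descends by a block `b` to `H (j - b)`
at the cost of a degree of `W b`. -/
theorem exists_blocks_of_descent {H N : ℤ → ℤ → Prop} {T : ℤ → Prop} {W : ℕ → ℤ → Prop}
    {t : ℕ → EReal} (ht : ∀ b d, W b d → ((d : ℝ) : EReal) ≤ t b) {i j₀ : ℤ}
    (hH : ∀ j ≤ j₀, ∀ e, ¬ H j e)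
    (hstep : ∀ j ≤ i, ∀ e, H j e → (∃ d, N j d ∧ T (e - d)) ∨
      ∃ j' < j, ∃ d, H j' d ∧ W (j - j').toNat (e - d)) {j : ℤ} (hj : j ≤ i) {e : ℤ} (he : H j e) :
    ∃ j' ≤ j, ∃ (d u s : ℤ) (l : List ℕ), N j' d ∧ T u ∧ e = d + s + u ∧ (∀ b ∈ l, 0 < b) ∧
      (l.sum : ℤ) = j - j' ∧ ((s : ℝ) : EReal) ≤ (l.map t).sum := by
  have hj₀ : j₀ < j := lt_of_not_ge fun hle => hH j hle e he
  induction h : (j - j₀).toNat using Nat.strong_induction_on generalizing j e with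
  | _ m ih =>
    obtain ⟨d, hN, hT⟩ | ⟨j', hj', d, hd, hW⟩ := hstep j hj e he
    · exact ⟨j, le_rfl, d, e - d, 0, [], hN, hT, by ring, by simp, by simp, by simp⟩
    · obtain ⟨j'', hj'', d', u, s, l, hN, hT, hdeg, hpos, hsum, hs⟩ := ih _ (by omega)
        (hj'.le.trans hj) hd (lt_of_not_ge fun hle => hH j' hle d hd) rfl
      refine ⟨j'', by omega, d', u, (e - d) + s, (j - j').toNat :: l, hN, hT, by rw [hdeg]; ring,
        List.forall_mem_cons.2 ⟨by omega, hpos⟩, ?_, ?_⟩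
      · rw [List.sum_cons, Nat.cast_add, hsum]
        omega
      · rw [List.map_cons, List.sum_cons, Int.cast_add, EReal.coe_add]
        exact add_le_add (ht _ _ hW) hs

theorem sum_map_torEnd_le_maxTorSum {k : Type w} [Field k] {B : Type u} [CommRing B] [Algebra k B]
    (𝒜 : ℤ → Submodule k B) (I : Ideal B) {j : ℤ} (hj : 0 < j) {l : List ℕ}
    (hl : ∀ b ∈ l, 0 < b) (hsum : (l.sum : ℤ) = j) :
    (l.map (torEnd 𝒜 (idealGrading 𝒜 I))).sum ≤ maxTorSum 𝒜 I j := by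
  rw [maxTorSum, if_pos hj]
  exact le_iSup (fun c : Composition j.toNat => (c.blocks.map (torEnd 𝒜 (idealGrading 𝒜 I))).sum)
    ⟨l, fun {b} hb => hl b hb, by omega⟩

theorem add_sum_torEnd_le_max {k : Type w} [Field k] {B : Type u} [CommRing B] [Algebra k B]
    (𝒜 : ℤ → Submodule k B) (I : Ideal B) (a : ℤ → EReal) {i j : ℤ} (hj : j ≤ i) {l : List ℕ}
    (hl : ∀ b ∈ l, 0 < b) (hsum : (l.sum : ℤ) = i - j) :
    a j + (l.map (torEnd 𝒜 (idealGrading 𝒜 I))).sum ≤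
      max (a i) (⨆ (j : ℤ) (_ : j < i), (a j + maxTorSum 𝒜 I (i - j))) := by
  rcases hj.eq_or_lt with rfl | hlt
  · obtain rfl : l = [] := List.eq_nil_iff_forall_not_mem.2 fun b hb => by
      have := List.le_sum_of_mem hb
      have := hl b hb
      omega
    rw [List.map_nil, List.sum_nil, add_zero]
    exact le_max_left _ _
  · refine le_max_of_le_right (le_iSup₂_of_le j hlt ?_)
    gcongr
    exact sum_map_torEnd_le_maxTorSum 𝒜 I (sub_pos.2 hlt) hl hsum

end GradedHomology

open GradedHomology in
theorem theorem4p4_general {k : Type w} [Field k] {B : Type u} [CommRing B] [Algebra k B]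
    [IsNoetherianRing B] (𝒜 : ℤ → Submodule k B) [GradedAlgebra 𝒜]
    (h𝒜_nonneg : ∀ d < 0, 𝒜 d = ⊥) (h𝒜_zero : 𝒜 0 = 1) (n : ℕ) (hn : ringKrullDim B ≤ n)
    {r : ℕ} (x : Fin r → B) (hx : IsCechFamily 𝒜 x)
    (L : ChainComplex (ModuleCat.{v} B) ℤ) (ℒ : (j : ℤ) → ℤ → AddSubgroup (L.X j))
    [∀ j, DirectSum.Decomposition (ℒ j)] [∀ j, SetLike.GradedSMul 𝒜 (ℒ j)]
    (hd : ∀ (a b d : ℤ), ∀ y ∈ ℒ a d, (L.d a b).hom y ∈ ℒ b d) (i : ℤ)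
    (hdepth : ∀ j ≤ i, (n : ℕ∞) ≤ lcDepth x (L.X j))
    (I : Ideal B) (hI : I.IsHomogeneous 𝒜) (hIdim : ringKrullDim (B ⧸ I) ≤ 0)
    (hIH : ∀ j ≤ i, ∀ a ∈ I, ∀ h : Homology L j, a • h = 0)
    (hH : ∃ j₀ : ℤ, ∀ j ≤ j₀, Subsingleton (Homology L j)) :
    homologyEnd L ℒ i ≤
      max (locCohEnd x 𝒜 (ℒ i) n)
          (⨆ (j : ℤ) (_ : j < i), (locCohEnd x 𝒜 (ℒ j) n + maxTorSum 𝒜 I (i - j)))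
        + torEnd 𝒜 (quotientGrading 𝒜 I) n := by
  have hxI := hx.exists_pow_mem (irrelevantIdeal_le_radical h𝒜_nonneg hI hIdim)
  have hcoh (j) (hj : j ≤ i) (p) (hp : p < n) : Subsingleton (LocCoh x (L.X j) p) :=
    subsingleton_locCoh_of_lt_lcDepth ((Nat.cast_lt.2 hp).trans_le (hdepth j hj))
  obtain ⟨j₀, hj₀⟩ := hH
  refine iSup₂_le fun e he => ?_
  obtain ⟨j, hj, d, u, s, l, hN, hT, rfl, hl, hsum, hs⟩ := exists_blocks_of_descent
    (H := fun j e => homologyGrading L ℒ j e ≠ ⊥) (N := fun j d => locCohGrading 𝒜 (ℒ j) x n d ≠ ⊥)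
    (T := fun u => torGrading 𝒜 (quotientGrading 𝒜 I) n u ≠ ⊥)
    (W := fun b d => torGrading 𝒜 (idealGrading 𝒜 I) b d ≠ ⊥) (fun _ _ => le_gradedEnd)
    (fun j hj e he => have := hj₀ j hj; he (Subsingleton.elim _ _))
    (fun j hj e he => exists_degree_of_homologyGrading_ne_bot hx h𝒜_nonneg h𝒜_zero hI hxI
      (fun j => DirectSum.Decomposition.isInternal (ℒ j)) hd hn
      (fun j' hj' => hcoh j' (hj'.trans hj)) (fun j' hj' => hIH j' (hj'.trans hj)) he)
    le_rfl he
  push_cast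
  exact add_le_add ((add_le_add (le_gradedEnd hN) hs).trans
    (add_sum_torEnd_le_max 𝒜 I (fun j => locCohEnd x 𝒜 (ℒ j) n) hj hl hsum)) (le_gradedEnd hT)

open GradedHomology in
theorem theorem4p4 {k : Type w} [Field k] {B : Type u} [CommRing B] [Nontrivial B] [Algebra k B]
    [IsNoetherianRing B]
    (𝒜 : ℤ → Submodule k B) [GradedAlgebra 𝒜]
    (h𝒜_nonneg : ∀ d < 0, 𝒜 d = ⊥) (h𝒜_zero : 𝒜 0 = 1)
    (n : ℕ) (hn : ringKrullDim B = n)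
    {r : ℕ} (x : Fin r → B) (hx : IsCechFamily 𝒜 x)
    (L : ChainComplex (ModuleCat.{v} B) ℤ) (ℒ : (j : ℤ) → ℤ → AddSubgroup (L.X j))
    [∀ j, DirectSum.Decomposition (ℒ j)] [∀ j, SetLike.GradedSMul 𝒜 (ℒ j)]
    (hd : ∀ (a b d : ℤ), ∀ y ∈ ℒ a d, (L.d a b).hom y ∈ ℒ b d)
    (i : ℤ)
    (hdepth : ∀ j ≤ i, (n : ℕ∞) ≤ lcDepth x (L.X j))
    (hbelow : ∀ j ≤ i, ∃ c : ℤ, ∀ d < c, ℒ j d = ⊥)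
    (I : Ideal B) (hI : I.IsHomogeneous 𝒜) (hIdim : ringKrullDim (B ⧸ I) = 0)
    (hIH : ∀ j ≤ i, ∀ a ∈ I, ∀ h : Homology L j, a • h = 0)
    (hH : ∃ j₀ : ℤ, ∀ j ≤ j₀, Subsingleton (Homology L j)) :
    homologyEnd L ℒ i ≤
      max (locCohEnd x 𝒜 (ℒ i) n)
          (⨆ (j : ℤ) (_ : j < i), (locCohEnd x 𝒜 (ℒ j) n + maxTorSum 𝒜 I (i - j)))
        + torEnd 𝒜 (quotientGrading 𝒜 I) n :=
  theorem4p4_general 𝒜 h𝒜_nonneg h𝒜_zero n hn.le x hx L ℒ hd i hdepth I hI hIdim.le hIH hH
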